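/- Let $d>3$ be an integer, $\bar d=d$ if $d$ is odd and $\bar d=2d$ if $d$ is even, $\omega=e^{2\pi i/d}$, $\tau=-e^{\pi i/d}$ and $\mathbb Z_n=\mathbb Z/n\mathbb Z$. On $\mathbb C^d$, with coordinates indexed by $\mathbb Z_d$, let $w$ be the shift $(w\mathbf z)_i=z_{i-1}$, let $h=\mathrm{diag}(1,\omega,\dots,\omega^{d-1})$, and put $\mathbf D_{\mathbf p}=\tau^{p_1p_2}w^{p_1}h^{p_2}$ for $\mathbf p\in\mathbb Z_{\bar d}^2$. A unit vector $\mathbf z\in\mathbb C^d$ is a \emph{fiducial} if the $d^2$ points $[w^ah^b\mathbf z]$, $(a,b)\in\mathbb Z_d^2$, are distinct and mutually equidistant in $\mathbb{CP}^{d-1}$, that is, $|\langle\mathbf x,\mathbf y\rangle|^2$ takes one and the same value in $(0,1)$ for all pairs $\mathbf x\neq\mathbf y$ of the vectors $w^ah^b\mathbf z$. Its overlap map is $\Phi_{\mathbf z}:\mathbb Z_{\bar d}^2\to\mathbb C$, $\Phi_{\mathbf z}(\mathbf p)=\langle\mathbf z,\mathbf D_{\mathbf p}\mathbf z\rangle$,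 and its overlap phases are the numbers $\Phi_{\mathbf z}(\mathbf p)$ with $\mathbf p\not\equiv0$ modulo $d$. Let $S=\{G\in\mathrm{GL}_2(\mathbb Z_{\bar d}):\Phi_{\mathbf z}\circ G=\Phi_{\mathbf z}\}$. The fiducial $\mathbf z$ is \emph{centred} if $S$ contains an element of order $3$ and trace $-1$, and every Clifford unitary $U$ (a unitary matrix that conjugates each $\mathbf D_{\mathbf p}$ to a scalar multiple of some $\mathbf D_{\mathbf q}$) which fixes $[\mathbf z]$ is displacement-free: there is $F\in\mathrm{GL}_2(\mathbb Z_{\bar d})$ with $U\mathbf D_{\mathbf p}U^{-1}=\mathbf D_{F\mathbf p}$ for all $\mathbf p$. Let $\mathbb K=\mathbb Q(\sqrt D)$, where $D$ is the square-free part of $(d-3)(d+1)$; let $\mathbb E_1$ be the extension of $\mathbb K$ generated by the values of $\Phi_{\mathbf z}$, and $\mathbb E$ the extension of $\mathbb K$ generated by $\tau$ and the entries of $\mathbf z\mathbf z^*$. A centred fiducial is \emph{strongly centred} if $\mathbb E=\mathbb E_1(i\sqrt{\bar d})$. Let $\mathcal G$ be the group of automorphisms of $\mathbb E_1$ that preserve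 the image of $\Phi_{\mathbf z}$ as an unordered set, and let $M$ be the group of all $G\in\mathrm{GL}_2(\mathbb Z_{\bar d})$ for which some $g\in\mathcal G$ satisfies $g\circ\Phi_{\mathbf z}=\Phi_{\mathbf z}\circ G$. Let $\mathbf z$ be a strongly centred fiducial, and assume the following standing conjecture: every $g\in\mathcal G$ satisfies $g\circ\Phi_{\mathbf z}=\Phi_{\mathbf z}\circ G_g$ for some $G_g\in\mathrm{GL}_2(\mathbb Z_{\bar d})$ (so that $g\mapsto G_gS$ describes the action of $\mathcal G$ by $M/S$), and $M$ is a maximal abelian subgroup of the centralizer of $S$ in $\mathrm{GL}_2(\mathbb Z_{\bar d})$. Then the overlap phases of $\mathbf z$ are all Galois conjugate, i.e. form a single orbit of $\mathcal G$, if and only if $d$ (which is $>3$) is an odd prime congruent to $2$ modulo $3$. -/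

import Mathlib

open Matrix

noncomputable section

namespace SIC

/-- The modulus `d̄` of the index group: `d` if `d` is odd, `2d` if `d` is even. -/
def dbar (d : ℕ) : ℕ := if Odd d then d else 2 * d

/-- `ω = e^{2πi/d}`. -/
def omega (d : ℕ) : ℂ := Complex.exp (2 * Real.pi * Complex.I / d)

/-- `τ = -e^{πi/d}`, a `d̄`-th root of unity. -/
def tau (d : ℕ) : ℂ := -Complex.exp (Real.pi * Complex.I / d)

/-- The index group `ℤ_d̄²` of the overlap phases. -/
abbrev Index (d : ℕ) : Type := Fin 2 → ZMod (dbar d)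

/-- The group `GL₂(ℤ_d̄)`. -/
abbrev GL2 (d : ℕ) : Type := GL (Fin 2) (ZMod (dbar d))

/-- The linear action of `GL₂(ℤ_d̄)` on `ℤ_d̄²`. -/
def act {d : ℕ} (G : GL2 d) (p : Index d) : Index d :=
  (G : Matrix (Fin 2) (Fin 2) (ZMod (dbar d))) *ᵥ p

theorem act_one {d : ℕ} (p : Index d) : act (1 : GL2 d) p = p := by
  simp [act]

theorem act_mul {d : ℕ} (G H : GL2 d) (p : Index d) : act (G * H) p = act G (act H p) := by
  simp only [act, Units.val_mul, Matrix.mulVec_mulVec]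

theorem act_act_inv {d : ℕ} (G : GL2 d) (p : Index d) : act G (act G⁻¹ p) = p := by
  rw [← act_mul, mul_inv_cancel, act_one]

/-- The shift matrix: `(w z)_i = z_{i-1}`, indices modulo `d`. -/
def shift (d : ℕ) : Matrix (ZMod d) (ZMod d) ℂ :=
  Matrix.of fun i j => if i = j + 1 then 1 else 0

/-- The clock matrix `h = diag(1, ω, …, ω^{d-1})`. -/
def clock (d : ℕ) : Matrix (ZMod d) (ZMod d) ℂ :=
  Matrix.diagonal fun j => omega d ^ j.val

variable {d : ℕ} [NeZero d]

/-- The displacement operator `D_p = τ^{p₁p₂} w^{p₁} h^{p₂}`. -/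
def disp (p : Index d) : Matrix (ZMod d) (ZMod d) ℂ :=
  tau d ^ ((p 0).val * (p 1).val) • (shift d ^ (p 0).val * clock d ^ (p 1).val)

/-- `|⟨x, y⟩|² / (‖x‖² ‖y‖²)`, which is `cos²` of half the Fubini–Study distance between
the points `[x]` and `[y]` of projective space. -/
def transProb (x y : ZMod d → ℂ) : ℝ :=
  ‖star x ⬝ᵥ y‖ ^ 2 / (‖star x ⬝ᵥ x‖ * ‖star y ⬝ᵥ y‖)

/-- `z` is a fiducial vector: it has unit norm and the `d²` points `[w^a h^b z]`,
`(a, b) ∈ ℤ_d²`, are mutually equidistant, i.e. form a SIC-POVM. -/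
def IsFiducial (z : ZMod d → ℂ) : Prop :=
  star z ⬝ᵥ z = 1 ∧
    ∃ c : ℝ, 0 < c ∧ c < 1 ∧ ∀ p q : ZMod d × ZMod d, p ≠ q →
      transProb ((shift d ^ p.1.val * clock d ^ p.2.val) *ᵥ z)
        ((shift d ^ q.1.val * clock d ^ q.2.val) *ᵥ z) = c

/-- The overlap map `Φ_z(p) = ⟨z, D_p z⟩`. -/
def overlap (z : ZMod d → ℂ) (p : Index d) : ℂ :=
  star z ⬝ᵥ (disp p *ᵥ z)

/-- The symmetry group `S = {G ∈ GL₂(ℤ_d̄) : Φ_z ∘ G = Φ_z}`. -/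
def symGroup (z : ZMod d → ℂ) : Subgroup (GL2 d) where
  carrier := {G | ∀ p, overlap z (act G p) = overlap z p}
  one_mem' := fun p => by rw [act_one]
  mul_mem' := fun {G H} hG hH p => by rw [act_mul, hG, hH]
  inv_mem' := fun {G} hG p => by
    have h := hG (act G⁻¹ p)
    rw [act_act_inv] at h
    exact h.symm

/-- A Clifford unitary: it normalizes the Heisenberg group up to phases. -/
def IsClifford (U : Matrix (ZMod d) (ZMod d) ℂ) : Prop :=
  U ∈ Matrix.unitaryGroup (ZMod d) ℂ ∧
    ∀ p : Index d, ∃ (q : Index d) (c : ℂ), U * disp p * Uᴴ = c • disp q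

/-- `U` is of the form `U_{F,0}` (up to a phase): `U D_p U⁻¹ = D_{Fp}` for some `F`, with no
displacement factor. -/
def IsDisplacementFree (U : Matrix (ZMod d) (ZMod d) ℂ) : Prop :=
  ∃ F : GL2 d, ∀ p, U * disp p * Uᴴ = disp (act F p)

/-- A centred fiducial: `S` contains an element of order `3` and trace `-1`, and each Clifford
unitary fixing the point `[z]` is displacement-free. -/
def IsCentred (z : ZMod d → ℂ) : Prop :=
  IsFiducial z ∧
    (∃ F ∈ symGroup z, orderOf F = 3 ∧
      (F : Matrix (Fin 2) (Fin 2) (ZMod (dbar d))).trace = -1) ∧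
    ∀ U : Matrix (ZMod d) (ZMod d) ℂ, IsClifford U → (∃ c : ℂ, U *ᵥ z = c • z) →
      IsDisplacementFree U

/-- The square-free part of a natural number. -/
def squarefreePart (n : ℕ) : ℕ := n.factorization.prod fun p k => p ^ (k % 2)

/-- `D`, the square-free part of `(d-3)(d+1)` (for `d > 3`). -/
def discPart (d : ℕ) : ℕ := squarefreePart ((d - 3) * (d + 1))

/-- The real quadratic field `K = ℚ(√D)`, as a subfield of `ℂ`. -/
def fieldK (d : ℕ) : IntermediateField ℚ ℂ :=
  IntermediateField.adjoin ℚ {((Real.sqrt (discPart d) : ℝ) : ℂ)}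

/-- `E₁`, the extension of `K` generated by the values of the overlap map. -/
def fieldE1 (z : ZMod d → ℂ) : IntermediateField ℚ ℂ :=
  fieldK d ⊔ IntermediateField.adjoin ℚ (Set.range (overlap z))

/-- `E`, the extension of `K` generated by `τ` and the entries of the projector `z z*`. -/
def fieldE (z : ZMod d → ℂ) : IntermediateField ℚ ℂ :=
  fieldK d ⊔ IntermediateField.adjoin ℚ
    ({tau d} ∪ Set.range fun ij : ZMod d × ZMod d => z ij.1 * star (z ij.2))

/-- A strongly centred fiducial: a centred fiducial with `E = E₁(i√d̄)`. -/
def IsStronglyCentred (z : ZMod d → ℂ) : Prop :=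
  IsCentred z ∧
    fieldE z = fieldE1 z ⊔
      IntermediateField.adjoin ℚ {Complex.I * ((Real.sqrt (dbar d) : ℝ) : ℂ)}

theorem overlap_mem (z : ZMod d → ℂ) (p : Index d) : overlap z p ∈ fieldE1 z :=
  (le_sup_right : IntermediateField.adjoin ℚ (Set.range (overlap z)) ≤ fieldE1 z)
    (IntermediateField.subset_adjoin ℚ _ ⟨p, rfl⟩)

/-- The overlap map with values in `E₁`. -/
def overlapE1 (z : ZMod d → ℂ) (p : Index d) : fieldE1 z := ⟨overlap z p, overlap_mem z p⟩

/-- The Galois group `𝒢`: the automorphisms of `E₁` that preserve the image of the overlap map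
as an unordered set. -/
def galGroup (z : ZMod d → ℂ) : Subgroup (fieldE1 z ≃ₐ[ℚ] fieldE1 z) where
  carrier := {g | ∀ x, g x ∈ Set.range (overlapE1 z) ↔ x ∈ Set.range (overlapE1 z)}
  one_mem' := fun _ => Iff.rfl
  mul_mem' := fun {g h} hg hh x => (hg (h x)).trans (hh x)
  inv_mem' := fun {g} hg x => by
    have h := hg (g⁻¹ x)
    have e : g (g⁻¹ x) = x := g.apply_symm_apply x
    rw [e] at h
    exact h.symm

/-- `g ∘ Φ_z = Φ_z ∘ G`: the automorphism `g` acts on the overlap phases through the matrix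
`G`. -/
def Implements (z : ZMod d → ℂ) (G : GL2 d) (g : fieldE1 z ≃ₐ[ℚ] fieldE1 z) : Prop :=
  ∀ p, g (overlapE1 z p) = overlapE1 z (act G p)

/-- The group `M` of all matrices `G` through which an element of `𝒢` acts on the overlap
phases. -/
def matGroup (z : ZMod d → ℂ) : Subgroup (GL2 d) where
  carrier := {G | ∃ g ∈ galGroup z, Implements z G g}
  one_mem' := ⟨1, one_mem _, fun p => by rw [act_one]; rfl⟩
  mul_mem' := by
    rintro G H ⟨g, hg, hG⟩ ⟨h, hh, hH⟩
    refine ⟨g * h, mul_mem hg hh, fun p => ?_⟩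
    rw [act_mul, ← hG, ← hH]
    rfl
  inv_mem' := by
    rintro G ⟨g, hg, hG⟩
    refine ⟨g⁻¹, inv_mem hg, fun p => ?_⟩
    have h := hG (act G⁻¹ p)
    rw [act_act_inv] at h
    rw [← h]
    exact g.symm_apply_apply _

/-- `A` is a maximal abelian subgroup of `C`. -/
def IsMaximalAbelianIn {Γ : Type*} [Group Γ] (A C : Subgroup Γ) : Prop :=
  Maximal (fun B : Subgroup Γ => B ≤ C ∧ ∀ x ∈ B, ∀ y ∈ B, x * y = y * x) A

/-- The standing conjecture: `g ↦ G_g S` identifies `𝒢` with `M / S` (each `g ∈ 𝒢` acts through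
some `G_g`, which is then determined up to `S`), and `M` is a maximal abelian subgroup of the
centralizer of `S`. -/
def MaximalAbelianConjecture (z : ZMod d → ℂ) : Prop :=
  (∀ g ∈ galGroup z, ∃ G : GL2 d, Implements z G g) ∧
    IsMaximalAbelianIn (matGroup z) (Subgroup.centralizer (symGroup z : Set (GL2 d)))

/-- `p` indexes an overlap phase: it is non-zero modulo `d`, i.e. `D_p` is not a scalar. (For `d`
odd this is `p ≠ 0`; for `d` even it also leaves out the three `p ≠ 0` with `D_p = 1`.) -/
def IsPhaseIndex (p : Index d) : Prop := ∃ i, ¬ d ∣ (p i).val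

/-- All overlap phases are Galois conjugate: they form a single orbit of `𝒢`. -/
def AllPhasesConjugate (z : ZMod d → ℂ) : Prop :=
  ∀ p q : Index d, IsPhaseIndex p → IsPhaseIndex q →
    ∃ g ∈ galGroup z, g (overlapE1 z p) = overlapE1 z q

end SIC

end

noncomputable section

namespace SIC

/-! ### Overlaps as a discrete Fourier transform; their common modulus. -/

section Ambiguity

/-! Two facts about `M` drive the proof. By maximality, every invertible matrix commuting with `M`
lies in `M`; in particular so does every invertible `a + bG` with `G ∈ M`. And if the phases form a
single orbit, then, `M` being abelian, an element of `M` fixing one phase fixes all of them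
(`overlap_act_eq`).

If `d` is a prime congruent to 2 modulo 3, the order-3 element `F` of `S` has no eigenvector modulo
`d`. So the matrices `a + bF` form a field with `d²` elements, and its nonzero members lie in `M`
and act transitively on nonzero indices.

Conversely, suppose there is a single orbit. In every other dimension one builds elements of `M`
that fix some index, hence all phases, and contradicts the fiducial property. For `d` even, `1 + dF`
fixes the phase at `(2, 0)` but negates the nonzero one at `(1, 0)`. If `d` is odd with two coprime
factors, or a power of a prime congruent to 1 modulo 3, each `G ∈ M` is a product of two elements of
`M` that each fix a nonzero index, so all phases coincide. For a power `l^k` with `k ≥ 2`, an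
element of `M` without eigenvector modulo `l` would make the overlaps periodic, which Fourier
inversion forbids (`IsFiducial.not_periodic`). This settles `l ≡ 2` through `F`. For `l = 3` it
leaves eigenvalues `±1`, so all phases share one real part. A constant real part is impossible for
odd `d ≥ 7` (`IsFiducial.not_re_eq`): it would give three orthogonal nonzero vectors in `ℂ²`. -/

theorem isPhaseIndex_iff {d : ℕ} (p : Index d) :
    IsPhaseIndex p ↔ (((p 0).val : ZMod d), ((p 1).val : ZMod d)) ≠ 0 := by
  simp only [IsPhaseIndex, Fin.exists_fin_two, ne_eq, Prod.mk_eq_zero,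
    ZMod.natCast_eq_zero_iff, not_and_or]

theorem dvd_dbar (d : ℕ) : d ∣ dbar d := by
  unfold dbar; split_ifs
  · exact dvd_rfl
  · exact Dvd.intro_left 2 rfl

theorem tau_sq (d : ℕ) : tau d ^ 2 = omega d := by
  rw [tau, neg_sq, omega, ← Complex.exp_nat_mul]
  congr 1; push_cast; ring

theorem norm_tau (d : ℕ) : ‖tau d‖ = 1 := by
  rw [tau, norm_neg, show (Real.pi * Complex.I / d : ℂ) = ((Real.pi / d : ℝ) : ℂ) * Complex.I by
    push_cast; ring, Complex.norm_exp_ofReal_mul_I]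

variable {d : ℕ} [NeZero d]

instance dbar_neZero : NeZero (dbar d) := ⟨by
  have := NeZero.ne d
  unfold dbar; split_ifs <;> omega⟩

theorem omega_pow_val (j : ZMod d) : omega d ^ j.val = ZMod.stdAddChar j := by
  rw [ZMod.stdAddChar_apply, ZMod.toCircle_apply, omega, ← Complex.exp_nat_mul]
  congr 1; ring

theorem tau_pow_self : tau d ^ d = (-1) ^ (d + 1) := by
  have hd : (d : ℂ) ≠ 0 := Nat.cast_ne_zero.2 (NeZero.ne d)
  rw [tau, neg_pow, ← Complex.exp_nat_mul, mul_div_cancel₀ _ hd, Complex.exp_pi_mul_I, pow_succ]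

theorem tau_pow_dbar : tau d ^ dbar d = 1 := by
  unfold dbar; split_ifs with h
  · rw [tau_pow_self, h.add_one.neg_one_pow]
  · rw [mul_comm, pow_mul, tau_pow_self, ← pow_mul, mul_comm, pow_mul]; simp

theorem norm_stdAddChar (j : ZMod d) : ‖(ZMod.stdAddChar j : ℂ)‖ = 1 := by
  rw [ZMod.stdAddChar_apply, Circle.norm_coe]

theorem star_stdAddChar (j : ZMod d) :
    star (ZMod.stdAddChar j : ℂ) = ZMod.stdAddChar (-j) := by
  rw [AddChar.map_neg_eq_inv, Complex.inv_def, Complex.normSq_eq_norm_sq, norm_stdAddChar]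
  simp

theorem shift_pow_mulVec (a : ℕ) (x : ZMod d → ℂ) (i : ZMod d) :
    (shift d ^ a *ᵥ x) i = x (i - a) := by
  induction a generalizing i with
  | zero => simp
  | succ a ih =>
    rw [pow_succ', ← mulVec_mulVec]
    have : ∀ y : ZMod d → ℂ, (shift d *ᵥ y) i = y (i - 1) := fun y => by
      simp only [mulVec, dotProduct, shift, of_apply, ite_mul, one_mul, zero_mul]
      rw [Finset.sum_eq_single (i - 1)] <;> simp
      intro b hb h; exact absurd (by rw [h]; ring) hb
    rw [this, ih]; congr 1; push_cast; ring

theorem clock_pow_mulVec (b : ℕ) (x : ZMod d → ℂ) (i : ZMod d) :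
    (clock d ^ b *ᵥ x) i = ZMod.stdAddChar (i * (b : ZMod d)) * x i := by
  rw [clock, diagonal_pow, mulVec_diagonal, Pi.pow_apply, omega_pow_val, ← AddChar.map_nsmul_eq_pow,
    nsmul_eq_mul, mul_comm i]

theorem shift_clock_mulVec (a b : ℕ) (x : ZMod d → ℂ) (i : ZMod d) :
    ((shift d ^ a * clock d ^ b) *ᵥ x) i = ZMod.stdAddChar ((i - (a : ZMod d)) * (b : ZMod d)) * x (i - a) := by
  rw [← mulVec_mulVec, shift_pow_mulVec, clock_pow_mulVec]

/-- The ambiguity function `(a, b) ↦ ⟨z, w^a h^b z⟩` in terms of the standard character. -/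
def ambiguity (z : ZMod d → ℂ) (a b : ZMod d) : ℂ :=
  ∑ j, star (z (j + a)) * (ZMod.stdAddChar (j * b) * z j)

theorem dotProduct_shift_clock (z : ZMod d → ℂ) (a b : ℕ) :
    star z ⬝ᵥ ((shift d ^ a * clock d ^ b) *ᵥ z) = ambiguity z a b := by
  unfold ambiguity dotProduct
  rw [← Equiv.sum_comp (Equiv.addRight (a : ZMod d))]
  simp [shift_clock_mulVec]

/-- Any natural representatives of the index may be used, because `τ` has order dividing `d̄` and
the ambiguity function only sees residues modulo `d`. -/
theorem overlap_of_cast (z : ZMod d → ℂ) (p : Index d) (a b : ℕ) (ha : p 0 = a) (hb : p 1 = b) :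
    overlap z p = tau d ^ (a * b) * ambiguity z a b := by
  have key : ∀ (x : ZMod (dbar d)) (c : ℕ), x = c → x.val ≡ c [MOD dbar d] := fun x c h => by
    rw [← ZMod.natCast_eq_natCast_iff, ZMod.natCast_zmod_val, h]
  have h0 := key _ _ ha
  have h1 := key _ _ hb
  have e0 := (ZMod.natCast_eq_natCast_iff _ _ d).2 (h0.of_dvd (dvd_dbar d))
  have e1 := (ZMod.natCast_eq_natCast_iff _ _ d).2 (h1.of_dvd (dvd_dbar d))
  rw [overlap, disp, smul_mulVec, dotProduct_smul, dotProduct_shift_clock, e0, e1, smul_eq_mul]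
  congr 1
  exact pow_eq_pow_of_modEq (h0.mul h1) tau_pow_dbar

theorem norm_overlap (z : ZMod d → ℂ) (p : Index d) :
    ‖overlap z p‖ = ‖ambiguity z ((p 0).val : ZMod d) ((p 1).val : ZMod d)‖ := by
  rw [overlap_of_cast z p (p 0).val (p 1).val (by simp) (by simp), norm_mul, norm_pow, norm_tau,
    one_pow, one_mul]

theorem ambiguity_zero_zero {z : ZMod d → ℂ} (hz : star z ⬝ᵥ z = 1) : ambiguity z 0 0 = 1 := by
  simpa [ambiguity, dotProduct] using hz

theorem dotProduct_shift_clock_self (z : ZMod d → ℂ) (a b : ℕ) :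
    star ((shift d ^ a * clock d ^ b) *ᵥ z) ⬝ᵥ ((shift d ^ a * clock d ^ b) *ᵥ z) =
      star z ⬝ᵥ z := by
  unfold dotProduct
  rw [← Equiv.sum_comp (Equiv.addRight (a : ZMod d))]
  refine Finset.sum_congr rfl fun j _ => ?_
  simp only [Pi.star_apply, shift_clock_mulVec, Equiv.coe_addRight, add_sub_cancel_right, star_mul']
  rw [star_stdAddChar, mul_mul_mul_comm, ← AddChar.map_add_eq_mul]
  simp

/-- Discrete Fourier inversion for the ambiguity function. -/
theorem sum_ambiguity (z : ZMod d → ℂ) (a k : ZMod d) :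
    ∑ b, ZMod.stdAddChar (-(k * b)) * ambiguity z a b = d * (star (z (k + a)) * z k) := by
  unfold ambiguity
  simp_rw [Finset.mul_sum]
  rw [Finset.sum_comm]
  have : ∀ j, ∑ b, (ZMod.stdAddChar (-(k * b)) : ℂ) *
      (star (z (j + a)) * (ZMod.stdAddChar (j * b) * z j)) =
      (if j - k = 0 then (d : ℂ) else 0) * (star (z (j + a)) * z j) := fun j => by
    have h := AddChar.sum_mulShift (R' := ℂ) (j - k) (ZMod.isPrimitive_stdAddChar d)
    rw [ZMod.card] at h
    have h' : (if j - k = 0 then (d : ℂ) else 0) = ∑ x : ZMod d, ZMod.stdAddChar (x * (j - k)) := by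
      rw [h]; split_ifs <;> simp
    rw [h', Finset.sum_mul]
    refine Finset.sum_congr rfl fun b _ => ?_
    rw [show b * (j - k) = -(k * b) + j * b by ring, AddChar.map_add_eq_mul]; ring
  simp_rw [this, sub_eq_zero, ite_mul, zero_mul]
  rw [Finset.sum_ite_eq' Finset.univ k]; simp

/-- Parseval's identity for the ambiguity function. -/
theorem sum_norm_sq_ambiguity (z : ZMod d → ℂ) (a : ZMod d) :
    ∑ b, ((‖ambiguity z a b‖ ^ 2 : ℝ) : ℂ) =
      d * ∑ k, (z (k + a) * star (z (k + a))) * (z k * star (z k)) := by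
  have : ∀ b, ((‖ambiguity z a b‖ ^ 2 : ℝ) : ℂ) = ∑ k, (z (k + a) * star (z k)) *
      (ZMod.stdAddChar (-(k * b)) * ambiguity z a b) := fun b => by
    push_cast
    rw [← Complex.conj_mul', ← Complex.star_def]
    nth_rw 1 [ambiguity]
    rw [star_sum, Finset.sum_mul]
    refine Finset.sum_congr rfl fun k _ => ?_
    simp only [star_mul', star_star, star_stdAddChar]; ring
  simp_rw [this]
  rw [Finset.sum_comm]
  simp_rw [← Finset.mul_sum, sum_ambiguity]
  rw [Finset.mul_sum]
  exact Finset.sum_congr rfl fun k _ => by ring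

/-- Parseval makes the squared moduli sum to `d`, the origin contributing 1. Hence `1 + (d² - 1)c =
d`, which determines the common value `c`. -/
theorem IsFiducial.norm_sq_ambiguity {z : ZMod d → ℂ} (hz : IsFiducial z) (a b : ZMod d)
    (hab : (a, b) ≠ 0) : ‖ambiguity z a b‖ ^ 2 = 1 / (d + 1) := by
  obtain ⟨h1, c, hc0, hc1, hc⟩ := hz
  have key : ∀ a b : ZMod d, (a, b) ≠ 0 → ‖ambiguity z a b‖ ^ 2 = c := fun a b hab => by
    have h := hc (0, 0) (a, b) hab.symm
    have h' := dotProduct_shift_clock z a.val b.val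
    rw [ZMod.natCast_zmod_val, ZMod.natCast_zmod_val] at h'
    rw [transProb, dotProduct_shift_clock_self, dotProduct_shift_clock_self, h1] at h
    simpa [h'] using h
  have hd : (0 : ℝ) < d := Nat.cast_pos.2 (NeZero.pos d)
  have htot : ∑ p : ZMod d × ZMod d, ‖ambiguity z p.1 p.2‖ ^ 2 = d := by
    have : ∑ p : ZMod d × ZMod d, ((‖ambiguity z p.1 p.2‖ ^ 2 : ℝ) : ℂ) = d := by
      rw [Fintype.sum_prod_type]
      simp_rw [sum_norm_sq_ambiguity]
      rw [← Finset.mul_sum, Finset.sum_comm]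
      simp_rw [← Finset.sum_mul]
      have h2 : ∀ k : ZMod d, ∑ a, z (k + a) * star (z (k + a)) = 1 := fun k => by
        rw [← h1]
        refine (Equiv.sum_comp (Equiv.addLeft k) fun x => z x * star (z x)).trans ?_
        exact Finset.sum_congr rfl fun j _ => mul_comm _ _
      simp_rw [h2, one_mul]
      have h3 := h2 0
      simp only [zero_add] at h3
      rw [h3, mul_one]
    exact_mod_cast this
  have h0 : ‖ambiguity z 0 0‖ ^ 2 = 1 := by rw [ambiguity_zero_zero h1]; simp
  rw [← Finset.add_sum_erase _ _ (Finset.mem_univ (0 : ZMod d × ZMod d)),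
    Finset.sum_congr rfl (g := fun _ => c) fun p hp => key p.1 p.2 (Finset.ne_of_mem_erase hp),
    Finset.sum_const, Finset.card_erase_of_mem (Finset.mem_univ _), Finset.card_univ,
    Fintype.card_prod, ZMod.card, nsmul_eq_mul, Prod.fst_zero, Prod.snd_zero, h0,
    Nat.cast_sub (Nat.one_le_iff_ne_zero.2 (mul_ne_zero (NeZero.ne d) (NeZero.ne d)))] at htot
  rw [key a b hab]
  push_cast at htot
  have hne : (d : ℝ) ≠ 1 := by
    rintro h
    have : d = 1 := by exact_mod_cast h
    subst this
    exact hab (Subsingleton.elim _ _)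
  field_simp
  have := sub_ne_zero.2 hne
  apply mul_left_cancel₀ this
  linarith

theorem IsFiducial.norm_sq_overlap {z : ZMod d → ℂ} (hz : IsFiducial z) (p : Index d)
    (hp : IsPhaseIndex p) : ‖overlap z p‖ ^ 2 = 1 / (d + 1) := by
  rw [norm_overlap, hz.norm_sq_ambiguity _ _ ((isPhaseIndex_iff p).1 hp)]

end Ambiguity

/-! ### Constraints on fiducials: real parts, coordinates, periods, signs. -/

section OddDimension

variable {d : ℕ} [NeZero d]

/-- The inverse of `2` modulo an odd number `d`. -/
def half (d : ℕ) : ZMod d := ((d + 1) / 2 : ℕ)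

theorem two_mul_half {d : ℕ} (h : Odd d) : 2 * half d = 1 := by
  obtain ⟨k, rfl⟩ := h
  have : (2 * k + 1 + 1) / 2 = k + 1 := by omega
  have e := ZMod.natCast_self (2 * k + 1)
  rw [half, this]
  push_cast at e ⊢
  linear_combination e

/-- For `d` odd `τ^d = 1`, so `τ = τ^(d+1) = ω^((d+1)/2)`. -/
theorem tau_pow_of_odd (h : Odd d) (a b : ℕ) :
    tau d ^ (a * b) = ZMod.stdAddChar (half d * (a : ZMod d) * (b : ZMod d)) := by
  have h1 : tau d = ZMod.stdAddChar (half d) := by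
    have e : tau d ^ (d + 1) = tau d := by
      rw [pow_succ, tau_pow_self, h.add_one.neg_one_pow, one_mul]
    rw [← e]
    obtain ⟨k, hk⟩ := h.add_one
    rw [hk, ← two_mul, pow_mul, tau_sq, half, hk, ← two_mul, Nat.mul_div_cancel_left _ two_pos]
    rw [← mul_one (k : ZMod d), ← nsmul_eq_mul, AddChar.map_nsmul_eq_pow]
    congr 1
    rcases eq_or_ne d 1 with rfl | hd
    · rw [Subsingleton.elim (1 : ZMod 1) 0, AddChar.map_zero_eq_one, omega]
      simp
    · have : Fact (1 < d) := ⟨by have := NeZero.ne d; omega⟩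
      rw [← omega_pow_val, ZMod.val_one, pow_one]
  rw [h1, ← AddChar.map_nsmul_eq_pow, nsmul_eq_mul]
  congr 1; push_cast; ring

/-- The overlap map of an odd dimension, as a function on `ℤ_d²`. -/
def oddOverlap (z : ZMod d → ℂ) (a b : ZMod d) : ℂ :=
  ZMod.stdAddChar (half d * a * b) * ambiguity z a b

theorem overlap_of_odd (h : Odd d) (z : ZMod d → ℂ) (p : Index d) (a b : ZMod d)
    (ha : p 0 = a.val) (hb : p 1 = b.val) : overlap z p = oddOverlap z a b := by
  rw [overlap_of_cast z p _ _ ha hb, tau_pow_of_odd h, oddOverlap, ZMod.natCast_zmod_val,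
    ZMod.natCast_zmod_val]

theorem ambiguity_neg_neg (z : ZMod d → ℂ) (a b : ZMod d) :
    ambiguity z (-a) (-b) = ZMod.stdAddChar (-(a * b)) * star (ambiguity z a b) := by
  unfold ambiguity
  rw [star_sum, Finset.mul_sum, ← Equiv.sum_comp (Equiv.addRight a)]
  refine Finset.sum_congr rfl fun j _ => ?_
  simp only [Equiv.coe_addRight, star_mul', star_star, star_stdAddChar]
  rw [show (j + a) * -b = -(a * b) + -(j * b) by ring, AddChar.map_add_eq_mul,
    add_neg_cancel_right]
  ring

theorem oddOverlap_neg_neg (h : Odd d) (z : ZMod d → ℂ) (a b : ZMod d) :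
    oddOverlap z (-a) (-b) = star (oddOverlap z a b) := by
  rw [oddOverlap, oddOverlap, ambiguity_neg_neg, star_mul', star_stdAddChar, ← mul_assoc,
    ← AddChar.map_add_eq_mul]
  congr 2
  linear_combination (a * b) * two_mul_half h

/-- Fourier inversion again; the symmetrizing factor moves the frequency to the midpoint of `k` and
`k + a`. -/
theorem sum_oddOverlap (z : ZMod d → ℂ) (a k : ZMod d) :
    ∑ b, ZMod.stdAddChar (-((k + half d * a) * b)) * oddOverlap z a b =
      d * (star (z (k + a)) * z k) := by
  rw [← sum_ambiguity]
  refine Finset.sum_congr rfl fun b _ => ?_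
  rw [oddOverlap, ← mul_assoc, ← AddChar.map_add_eq_mul]
  congr 2
  ring

theorem oddOverlap_zero_zero {z : ZMod d → ℂ} (hz : star z ⬝ᵥ z = 1) : oddOverlap z 0 0 = 1 := by
  simp [oddOverlap, ambiguity_zero_zero hz]

theorem IsFiducial.norm_sq_oddOverlap {z : ZMod d → ℂ} (hz : IsFiducial z) (a b : ZMod d)
    (hab : (a, b) ≠ 0) : ‖oddOverlap z a b‖ ^ 2 = 1 / (d + 1) := by
  rw [oddOverlap, norm_mul, norm_stdAddChar, one_mul, hz.norm_sq_ambiguity a b hab]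

theorem sum_stdAddChar_neg_mul (k : ZMod d) :
    ∑ b, (ZMod.stdAddChar (-(k * b)) : ℂ) = if k = 0 then (d : ℂ) else 0 := by
  have h := AddChar.sum_mulShift (R' := ℂ) (-k) (ZMod.isPrimitive_stdAddChar d)
  rw [ZMod.card] at h
  simp_rw [neg_eq_zero] at h
  push_cast at h
  rw [← h]
  exact Finset.sum_congr rfl fun b _ => by congr 1; ring

/-- If the real part of the overlap map is constant away from the origin, then the vectors
`(z_k, z_{-k})` have prescribed inner products. -/
theorem star_mul_add_of_re_eq (h : Odd d) {z : ZMod d → ℂ} (hz : star z ⬝ᵥ z = 1) (x : ℝ)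
    (hx : ∀ a b : ZMod d, (a, b) ≠ 0 → (oddOverlap z a b).re = x) (k l : ZMod d)
    (hkl : k + l ≠ 0) : d * (star (z l) * z k + star (z (-l)) * z (-k)) =
      if k = l then ((2 * (1 - x) : ℝ) : ℂ) else 0 := by
  have h2 := two_mul_half h
  have e1 := sum_oddOverlap z (l - k) k
  have e2 := sum_oddOverlap z (-(l - k)) (-k)
  rw [← Equiv.sum_comp (Equiv.neg (ZMod d))] at e2
  simp only [Equiv.neg_apply, oddOverlap_neg_neg h] at e2
  rw [show k + (l - k) = l by ring] at e1
  rw [show -k + -(l - k) = -l by ring] at e2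
  rw [mul_add, ← e1, ← e2, ← Finset.sum_add_distrib]
  set s := k + half d * (l - k) with hs
  -- `s` is the midpoint `(k + l)/2`; being nonzero, it annihilates the constant part of the sum
  -- below. Only the value 1 at the origin, met when `k = l`, leaves a correction.
  have hs0 : s ≠ 0 := fun h0 => hkl (by linear_combination 2 * h0 - (l - k) * h2)
  have : ∀ b, (ZMod.stdAddChar (-(s * b)) : ℂ) * oddOverlap z (l - k) b +
      ZMod.stdAddChar (-((-k + half d * -(l - k)) * -b)) * star (oddOverlap z (l - k) b) =
      2 * x * ZMod.stdAddChar (-(s * b)) + if b = 0 then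
        (if k = l then ((2 * (1 - x) : ℝ) : ℂ) else 0) else 0 := fun b => by
    rw [show -((-k + half d * -(l - k)) * -b) = -(s * b) by rw [hs]; ring, ← mul_add,
      Complex.star_def, Complex.add_conj]
    by_cases hb : b = 0
    · subst hb
      by_cases hkl' : k = l
      · subst hkl'
        simp [oddOverlap_zero_zero hz]; ring
      · rw [hx _ _ (by simp [sub_eq_zero, Ne.symm hkl'])]
        simp [hkl']
    · rw [hx _ _ (by simp [hb])]
      simp [hb]; ring
  rw [Finset.sum_congr rfl fun b _ => this b, Finset.sum_add_distrib, ← Finset.mul_sum,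
    sum_stdAddChar_neg_mul, if_neg hs0]
  simp

/-- In `ℂ²` two vectors orthogonal to a nonzero `(u, v)` are parallel; if they are also orthogonal
to each other, one of them vanishes. -/
theorem eq_zero_of_orthogonal {a b c e u v : ℂ} (h1 : star u * a + star v * b = 0)
    (h2 : star u * c + star v * e = 0) (h3 : star a * c + star b * e = 0)
    (hu : star u * u + star v * v ≠ 0) (ha : star a * a + star b * b ≠ 0) :
    star c * c + star e * e = 0 := by
  have hdet : a * e = b * c := by
    have h4 : star u * (a * e - b * c) = 0 := by linear_combination e * h1 - b * h2
    have h5 : star v * (a * e - b * c) = 0 := by linear_combination a * h2 - c * h1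
    by_contra hne
    have hne' := sub_ne_zero.2 hne
    apply hu
    rw [(mul_eq_zero.1 h4).resolve_right hne', (mul_eq_zero.1 h5).resolve_right hne']
    ring
  have hc : (star a * a + star b * b) * c = 0 := by linear_combination a * h3 - star b * hdet
  have he : (star a * a + star b * b) * e = 0 := by linear_combination b * h3 + star a * hdet
  rw [(mul_eq_zero.1 hc).resolve_left ha, (mul_eq_zero.1 he).resolve_left ha]
  ring

/-- The vectors `(z_k, z_{-k})` for `k = 1, 2, 3` would be nonzero and pairwise orthogonal in `ℂ²`.
The bound on `d` keeps the sums `k + l`, which reach 6, away from 0. -/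
theorem IsFiducial.not_re_eq (h : Odd d) (hd : 7 ≤ d) {z : ZMod d → ℂ} (hz : IsFiducial z)
    (x : ℝ) (hx : ∀ a b : ZMod d, (a, b) ≠ 0 → (oddOverlap z a b).re = x) : False := by
  have key := star_mul_add_of_re_eq h hz.1 x hx
  have hd0 : (d : ℂ) ≠ 0 := Nat.cast_ne_zero.2 (NeZero.ne d)
  have hne : ∀ n : ℕ, 0 < n → n < 7 → (n : ZMod d) ≠ 0 := fun n h0 h7 hn => by
    rw [ZMod.natCast_eq_zero_iff] at hn
    have := Nat.le_of_dvd h0 hn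
    omega
  have h1 : (1 : ZMod d) ≠ 0 := by simpa using hne 1 (by norm_num) (by norm_num)
  have h2 : (2 : ZMod d) ≠ 0 := by simpa using hne 2 (by norm_num) (by norm_num)
  have h3 : (3 : ZMod d) ≠ 0 := by simpa using hne 3 (by norm_num) (by norm_num)
  have h4 : (4 : ZMod d) ≠ 0 := by simpa using hne 4 (by norm_num) (by norm_num)
  have h5 : (5 : ZMod d) ≠ 0 := by simpa using hne 5 (by norm_num) (by norm_num)
  have h6 : (6 : ZMod d) ≠ 0 := by simpa using hne 6 (by norm_num) (by norm_num)
  have n12 : (1 : ZMod d) ≠ 2 := fun e => h1 (by linear_combination -e)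
  have n13 : (1 : ZMod d) ≠ 3 := fun e => h2 (by linear_combination -e)
  have n23 : (2 : ZMod d) ≠ 3 := fun e => h1 (by linear_combination -e)
  have hx1 : x ≠ 1 := by
    have e1 := hx 1 0 (by simp [h1])
    have e2 := hz.norm_sq_oddOverlap 1 0 (by simp [h1])
    have e3 := Complex.abs_re_le_norm (oddOverlap z 1 0)
    rintro rfl
    rw [e1, abs_one] at e3
    have hd' : (7 : ℝ) ≤ d := by exact_mod_cast hd
    have : (1 : ℝ) / (d + 1) < 1 := by rw [div_lt_one] <;> linarith
    nlinarith
  have hc : ((2 * (1 - x) : ℝ) : ℂ) ≠ 0 := by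
    rw [Complex.ofReal_ne_zero]
    exact mul_ne_zero two_ne_zero (sub_ne_zero.2 hx1.symm)
  have diag : ∀ k : ZMod d, k + k ≠ 0 → star (z k) * z k + star (z (-k)) * z (-k) ≠ 0 :=
    fun k hkk h0 => hc (by
      have := key k k hkk
      rwa [if_pos rfl, h0, mul_zero, eq_comm] at this)
  have off : ∀ k l : ZMod d, k + l ≠ 0 → k ≠ l →
      star (z l) * z k + star (z (-l)) * z (-k) = 0 := fun k l hkl hne => by
    have := key k l hkl
    rw [if_neg hne] at this
    exact (mul_eq_zero.1 this).resolve_left hd0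
  have t2 : (1 : ZMod d) + 1 = 2 := by norm_num
  have t3 : (1 : ZMod d) + 2 = 3 := by norm_num
  have t3' : (2 : ZMod d) + 1 = 3 := by norm_num
  have t4 : (2 : ZMod d) + 2 = 4 := by norm_num
  have t4' : (1 : ZMod d) + 3 = 4 := by norm_num
  have t5 : (2 : ZMod d) + 3 = 5 := by norm_num
  have t6 : (3 : ZMod d) + 3 = 6 := by norm_num
  refine diag 2 (t4 ▸ h4) (eq_zero_of_orthogonal (off 1 3 (t4' ▸ h4) n13)
    (off 2 3 (t5 ▸ h5) n23) (off 2 1 (t3' ▸ h3) n12.symm)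
    (diag 3 (t6 ▸ h6)) (diag 1 (t2 ▸ h2)))

/-- A fiducial in dimension `d = ℓ m` with `ℓ ≤ m` has a non-zero coordinate in each residue
class modulo `ℓ`. -/
theorem IsFiducial.exists_ne_zero {z : ZMod d → ℂ} (hz : IsFiducial z) {l m : ℕ} (hl : 1 ≤ l)
    (hlm : l ≤ m) (hd : d = l * m) (s : ZMod d) :
    ∃ j : ZMod d, (j - s) * (m : ZMod d) = 0 ∧ z j ≠ 0 := by
  by_contra! hcon
  have hlm0 : (l : ZMod d) * m = 0 := by rw [← Nat.cast_mul, ← hd, ZMod.natCast_self]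
  -- Averaging over the powers of `h^m` projects onto the class of `s`, where `z` is assumed to
  -- vanish. The term `t = 0` is 1 and the other `l - 1` have modulus `1/√(d+1)`, so `(l - 1)² ≥ d +
  -- 1`, against `l ≤ m`.
  have hsum : ∑ t ∈ Finset.range l,
      (ZMod.stdAddChar (-(s * (m * t : ZMod d))) : ℂ) * ambiguity z 0 (m * t) = 0 := by
    unfold ambiguity
    simp_rw [Finset.mul_sum]
    rw [Finset.sum_comm]
    refine Finset.sum_eq_zero fun j _ => ?_
    by_cases hj : (j - s) * (m : ZMod d) = 0
    · simp [hcon j hj]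
    · have : ∀ t : ℕ, (ZMod.stdAddChar (-(s * (m * t : ZMod d))) : ℂ) *
          (star (z (j + 0)) * (ZMod.stdAddChar (j * (m * t : ZMod d)) * z j)) =
          ZMod.stdAddChar ((j - s) * (m : ZMod d)) ^ t * (star (z j) * z j) := fun t => by
        rw [← AddChar.map_nsmul_eq_pow, nsmul_eq_mul,
          show (t : ZMod d) * ((j - s) * (m : ZMod d)) = -(s * (m * t)) + j * (m * t) by ring,
          AddChar.map_add_eq_mul, add_zero]
        ring
      rw [Finset.sum_congr rfl fun t _ => this t, ← Finset.sum_mul]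
      have hne : (ZMod.stdAddChar ((j - s) * (m : ZMod d)) : ℂ) - 1 ≠ 0 := fun h0 =>
        hj (ZMod.injective_stdAddChar (by
          rw [AddChar.map_zero_eq_one]; exact sub_eq_zero.1 h0))
      have hgeom := mul_geom_sum (ZMod.stdAddChar ((j - s) * (m : ZMod d)) : ℂ) l
      rw [← AddChar.map_nsmul_eq_pow, nsmul_eq_mul,
        show (l : ZMod d) * ((j - s) * (m : ZMod d)) = (j - s) * (l * m) by ring, hlm0, mul_zero,
        AddChar.map_zero_eq_one, sub_self] at hgeom
      rw [(mul_eq_zero.1 hgeom).resolve_left hne, zero_mul]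
  obtain ⟨k, rfl⟩ : ∃ k, l = k + 1 := ⟨l - 1, by omega⟩
  rw [Finset.sum_range_succ', Nat.cast_zero, mul_zero, mul_zero, neg_zero,
    AddChar.map_zero_eq_one, one_mul, ambiguity_zero_zero hz.1] at hsum
  have hnorm : ∀ t ∈ Finset.range k, ‖(ZMod.stdAddChar (-(s * (m * (t + 1 : ℕ) : ZMod d))) : ℂ) *
      ambiguity z 0 (m * (t + 1 : ℕ))‖ ≤ √(1 / (d + 1)) := fun t ht => by
    rw [norm_mul, norm_stdAddChar, one_mul]
    refine Real.le_sqrt_of_sq_le (hz.norm_sq_ambiguity _ _ ?_).le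
    rw [← Nat.cast_mul]
    simp only [ne_eq, Prod.mk_eq_zero, true_and, ZMod.natCast_eq_zero_iff]
    rw [hd, mul_comm (k + 1), Nat.mul_dvd_mul_iff_left (by omega)]
    intro hdvd
    have := Nat.le_of_dvd (by omega) hdvd
    have := Finset.mem_range.1 ht
    omega
  have hle := norm_sum_le_of_le _ hnorm
  rw [eq_neg_of_add_eq_zero_left hsum, norm_neg, norm_one, Finset.sum_const, Finset.card_range,
    nsmul_eq_mul] at hle
  have hsq : (1 : ℝ) ≤ k ^ 2 * (1 / (d + 1)) := by
    have := Real.sq_sqrt (show (0 : ℝ) ≤ 1 / (d + 1) by positivity)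
    nlinarith
  have hpos : (0 : ℝ) < d + 1 := by positivity
  rw [mul_one_div, le_div_iff₀ hpos, one_mul] at hsq
  have hk : (d : ℝ) = (k + 1) * m := by rw [hd]; push_cast; ring
  have hm : (k + 1 : ℝ) ≤ m := by exact_mod_cast hlm
  have hk0 : (0 : ℝ) ≤ k := Nat.cast_nonneg k
  nlinarith

/-- In dimension `d = ℓ m` with `2 ≤ ℓ ≤ m`, the overlap map of a fiducial is not invariant under
the translations `(a, b) ↦ (a, b + m)` with `a` prime to `ℓ`. -/
theorem IsFiducial.not_periodic (h : Odd d) {z : ZMod d → ℂ} (hz : IsFiducial z) {l m : ℕ}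
    (hl : 2 ≤ l) (hlm : l ≤ m) (hd : d = l * m)
    (hinv : ∀ a b : ZMod d, (a - 1) * (m : ZMod d) = 0 → oddOverlap z a (b + m) = oddOverlap z a b) :
    False := by
  -- With `x ≡ 0` and `y ≡ 1` modulo `l`, the Fourier coefficient of `oddOverlap z (y - x)` at the
  -- midpoint of `x` and `y` is nonzero. Periodicity then forces `(x + y)m/2 = 0`, whereas `(x + y)m
  -- = m`.
  obtain ⟨x, hx, hzx⟩ := hz.exists_ne_zero (by omega) hlm hd 0
  obtain ⟨y, hy, hzy⟩ := hz.exists_ne_zero (by omega) hlm hd 1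
  have e := sum_oddOverlap z (y - x) x
  have ha : (y - x - 1) * (m : ZMod d) = 0 := by linear_combination hy - hx
  have hne : (d * (star (z y) * z x) : ℂ) ≠ 0 :=
    mul_ne_zero (Nat.cast_ne_zero.2 (NeZero.ne d)) (mul_ne_zero (star_ne_zero.2 hzy) hzx)
  rw [add_sub_cancel] at e
  have e' := e
  rw [← Equiv.sum_comp (Equiv.addRight (m : ZMod d))] at e'
  simp only [Equiv.coe_addRight, hinv _ _ ha, mul_add, neg_add, AddChar.map_add_eq_mul] at e'
  simp_rw [mul_right_comm _ _ (oddOverlap z _ _)] at e'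
  rw [← Finset.sum_mul, e] at e'
  have h1 := mul_left_cancel₀ hne (e'.trans (mul_one _).symm)
  have h2 : -((x + half d * (y - x)) * (m : ZMod d)) = 0 :=
    ZMod.injective_stdAddChar (by rw [h1, AddChar.map_zero_eq_one])
  have h3 : (m : ZMod d) = 0 := by
    linear_combination -2 * h2 - (y - x) * m * two_mul_half h - hx - hy
  rw [ZMod.natCast_eq_zero_iff, hd] at h3
  have := Nat.le_of_dvd (by omega) h3
  nlinarith

/-- In even dimension, translating the index by `(d f, d g)` with `g` odd changes the sign of the
overlap at `(1, 0)`. -/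
theorem overlap_translate_of_even (h : Even d) (z : ZMod d → ℂ) (p q : Index d) (f g : ℕ)
    (hg : Odd g) (hp0 : p 0 = 1) (hp1 : p 1 = 0) (hq0 : q 0 = (1 + d * f : ℕ))
    (hq1 : q 1 = (d * g : ℕ)) : overlap z q = -overlap z p := by
  rw [overlap_of_cast z q _ _ hq0 hq1, overlap_of_cast z p 1 0 (by simpa using hp0)
    (by simpa using hp1)]
  have h1 : tau d ^ d = -1 := by rw [tau_pow_self, h.add_one.neg_one_pow]
  rw [show (1 + d * f) * (d * g) = d * g + d * (d * (f * g)) by ring, pow_add, pow_mul, pow_mul,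
    h1, hg.neg_one_pow, pow_mul, h.neg_one_pow]
  simp

end OddDimension

/-! ### Two-by-two matrices over a field. -/

section Field

variable {K : Type*} [Field K]

/-- A `2 × 2` matrix without eigenvectors. -/
def NoEigenvector (A : Matrix (Fin 2) (Fin 2) K) : Prop :=
  ∀ v : Fin 2 → K, v ≠ 0 → ∀ c : K, A *ᵥ v ≠ c • v

theorem mulVec_fin_two {R : Type*} [CommRing R] (A : Matrix (Fin 2) (Fin 2) R) (v : Fin 2 → R) :
    A *ᵥ v = ![A 0 0 * v 0 + A 0 1 * v 1, A 1 0 * v 0 + A 1 1 * v 1] := by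
  ext i
  fin_cases i <;> simp [mulVec, dotProduct, Fin.sum_univ_two]

theorem exists_smul_of_det_eq_zero {v w : Fin 2 → K} (hv : v ≠ 0)
    (h : v 0 * w 1 - v 1 * w 0 = 0) : ∃ c : K, w = c • v := by
  by_cases h0 : v 0 = 0
  · have h1 : v 1 ≠ 0 := fun h1 => hv (by ext i; fin_cases i <;> simp [h0, h1])
    have hw : w 0 = 0 := by
      rw [h0] at h
      simpa [h1] using h
    refine ⟨w 1 / v 1, ?_⟩
    ext i
    fin_cases i
    · simp [h0, hw]
    · simp [h1]
  · refine ⟨w 0 / v 0, ?_⟩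
    ext i
    fin_cases i
    · simp [h0]
    · simp only [Fin.mk_one, Pi.smul_apply, smul_eq_mul]
      field_simp
      linear_combination h

/-- `v` and `Av` form a basis; the coefficients come from Cramer's rule. -/
theorem NoEigenvector.exists_smul_add {A : Matrix (Fin 2) (Fin 2) K} (hA : NoEigenvector A)
    {v : Fin 2 → K} (hv : v ≠ 0) (w : Fin 2 → K) :
    ∃ a b : K, (a • (1 : Matrix (Fin 2) (Fin 2) K) + b • A) *ᵥ v = w := by
  set u := A *ᵥ v with hu
  have hdet : v 0 * u 1 - v 1 * u 0 ≠ 0 := fun h => by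
    obtain ⟨c, hc⟩ := exists_smul_of_det_eq_zero hv h
    exact hA v hv c hc
  refine ⟨(w 0 * u 1 - w 1 * u 0) / (v 0 * u 1 - v 1 * u 0),
    (v 0 * w 1 - v 1 * w 0) / (v 0 * u 1 - v 1 * u 0), ?_⟩
  rw [add_mulVec, smul_mulVec, smul_mulVec, one_mulVec, ← hu]
  ext i
  fin_cases i
  · simp only [Fin.zero_eta, Pi.add_apply, Pi.smul_apply, smul_eq_mul]
    rw [div_mul_eq_mul_div, div_mul_eq_mul_div, ← add_div, div_eq_iff hdet]; ring
  · simp only [Fin.mk_one, Pi.add_apply, Pi.smul_apply, smul_eq_mul]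
    rw [div_mul_eq_mul_div, div_mul_eq_mul_div, ← add_div, div_eq_iff hdet]; ring

/-- A kernel vector of `a + bA` with `b ≠ 0` would be an eigenvector of `A` for `-a/b`: the algebra
generated by `A` is a field. -/
theorem NoEigenvector.det_ne_zero {A : Matrix (Fin 2) (Fin 2) K} (hA : NoEigenvector A) {a b : K}
    {v : Fin 2 → K} (h : (a • (1 : Matrix (Fin 2) (Fin 2) K) + b • A) *ᵥ v ≠ 0) :
    (a • (1 : Matrix (Fin 2) (Fin 2) K) + b • A).det ≠ 0 := by
  intro hdet
  obtain ⟨u, hu, hu0⟩ := exists_mulVec_eq_zero_iff.2 hdet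
  rw [add_mulVec, smul_mulVec, smul_mulVec, one_mulVec] at hu0
  by_cases hb : b = 0
  · subst hb
    rw [zero_smul, add_zero] at hu0
    rcases smul_eq_zero.1 hu0 with rfl | h'
    · simp at h
    · exact hu h'
  · refine hA u hu (-(a / b)) ?_
    rw [add_comm, add_eq_zero_iff_eq_neg] at hu0
    rw [← inv_smul_smul₀ hb (A *ᵥ u), hu0, ← neg_smul, smul_smul]
    congr 1
    ring

theorem eigenvalue_cube {A : Matrix (Fin 2) (Fin 2) K} (hA : A ^ 3 = 1) {v : Fin 2 → K}
    (hv : v ≠ 0) {c : K} (h : A *ᵥ v = c • v) : c ^ 3 = 1 := by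
  have h3 : A ^ 3 *ᵥ v = c ^ 3 • v := by
    rw [show A ^ 3 = A * (A * A) by noncomm_ring, ← mulVec_mulVec, ← mulVec_mulVec, h,
      mulVec_smul, h, mulVec_smul, mulVec_smul, h, smul_smul, smul_smul]
    congr 1; ring
  rw [hA, one_mulVec] at h3
  by_contra hc
  have : (c ^ 3 - 1) • v = 0 := by rw [sub_smul, ← h3, one_smul, sub_self]
  exact (smul_eq_zero.1 this).elim (sub_ne_zero.2 hc) hv

theorem eigenvalue_quadratic {A : Matrix (Fin 2) (Fin 2) K} {v : Fin 2 → K}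
    (hv : v ≠ 0) {c : K} (h : A *ᵥ v = c • v) : c ^ 2 - A.trace * c + A.det = 0 := by
  have : (A - c • (1 : Matrix (Fin 2) (Fin 2) K)).det = 0 :=
    exists_mulVec_eq_zero_iff.1 ⟨v, hv, by
      rw [sub_mulVec, smul_mulVec, one_mulVec, h, sub_self]⟩
  rw [det_fin_two] at this
  simp at this
  rw [det_fin_two, trace_fin_two]
  linear_combination this

theorem exists_eigenvector {A : Matrix (Fin 2) (Fin 2) K} {c : K}
    (h : c ^ 2 - A.trace * c + A.det = 0) : ∃ v ≠ 0, A *ᵥ v = c • v := by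
  have : (A - c • (1 : Matrix (Fin 2) (Fin 2) K)).det = 0 := by
    rw [det_fin_two]
    simp
    rw [det_fin_two, trace_fin_two] at h
    linear_combination h
  obtain ⟨v, hv, h0⟩ := exists_mulVec_eq_zero_iff.2 this
  refine ⟨v, hv, ?_⟩
  rwa [sub_mulVec, smul_mulVec, one_mulVec, sub_eq_zero] at h0

/-- Take traces in `A³ = 1`: when `tr A = -1`, `tr A³ = 3 det A - 1`, and this equals 2. -/
theorem det_eq_one_of_cube (h3 : (3 : K) ≠ 0) {A : Matrix (Fin 2) (Fin 2) K} (hA : A ^ 3 = 1)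
    (htr : A.trace = -1) : A.det = 1 := by
  rw [trace_fin_two] at htr
  rw [pow_three] at hA
  have e00 := congrFun (congrFun hA 0) 0
  have e11 := congrFun (congrFun hA 1) 1
  simp only [mul_apply, Fin.sum_univ_two, one_apply_eq] at e00 e11
  have h2 : A 1 1 = -1 - A 0 0 := by linear_combination htr
  rw [h2] at e00 e11
  rw [det_fin_two, h2]
  apply mul_left_cancel₀ h3
  linear_combination e00 + e11

/-- The eigenspaces of a matrix of trace `-1` for a primitive cube root of unity are lines. -/
theorem exists_smul_of_eigenvector (h3 : (3 : K) ≠ 0) {A : Matrix (Fin 2) (Fin 2) K}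
    (htr : A.trace = -1) {c : K} (hc : c ^ 2 + c + 1 = 0) {v w : Fin 2 → K} (hv : v ≠ 0)
    (hAv : A *ᵥ v = c • v) (hAw : A *ᵥ w = c • w) : ∃ a : K, w = a • v := by
  apply exists_smul_of_det_eq_zero hv
  rw [trace_fin_two] at htr
  rw [mulVec_fin_two] at hAv hAw
  have v0 := congrFun hAv 0
  have v1 := congrFun hAv 1
  have w0 := congrFun hAw 0
  have w1 := congrFun hAw 1
  simp at v0 v1 w0 w1
  -- This is `det(Av, w) + det(v, Aw) = tr A · det(v, w)`; moreover `(2c + 1)² = -3`.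
  have hprod : (2 * c + 1) * (v 0 * w 1 - v 1 * w 0) = 0 := by
    linear_combination -w 1 * v0 + w 0 * v1 - v 0 * w1 + v 1 * w0 +
      (v 0 * w 1 - v 1 * w 0) * htr
  refine (mul_eq_zero.1 hprod).resolve_left fun h => h3 ?_
  linear_combination 4 * hc - (2 * c + 1) * h

end Field

/-! ### Cube roots of unity modulo a prime. -/

section Prime

variable {l : ℕ} [Fact l.Prime]

theorem three_ne_zero_of_prime (h : l ≠ 3) : (3 : ZMod l) ≠ 0 := fun h3 => h (by
  have : ((3 : ℕ) : ZMod l) = 0 := by exact_mod_cast h3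
  rw [ZMod.natCast_eq_zero_iff] at this
  exact (Nat.prime_dvd_prime_iff_eq Fact.out Nat.prime_three).1 this)

/-- An eigenvalue is a cube root of unity, hence 1 since 3 does not divide `l - 1`; but the
characteristic polynomial `c² + c + 1` takes the value 3 there. -/
theorem noEigenvector_of_mod_three (h : l % 3 = 2) {A : Matrix (Fin 2) (Fin 2) (ZMod l)}
    (hA : A ^ 3 = 1) (htr : A.trace = -1) : NoEigenvector A := by
  intro v hv c hc
  have h3 : (3 : ZMod l) ≠ 0 := three_ne_zero_of_prime (by omega)
  have c3 := eigenvalue_cube hA hv hc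
  have c0 : c ≠ 0 := by rintro rfl; simp at c3
  have c1 : c = 1 := by
    have e := ZMod.pow_card_sub_one_eq_one c0
    rwa [show l - 1 = 3 * (l / 3) + 1 by omega, pow_succ, pow_mul, c3, one_pow, one_mul] at e
  have e := eigenvalue_quadratic hv hc
  rw [htr, det_eq_one_of_cube h3 hA htr, c1] at e
  exact h3 (by linear_combination e)

theorem exists_primitive_cube_root (h : l % 3 = 1) : ∃ c : ZMod l, c ^ 2 + c + 1 = 0 := by
  have : Fact (Nat.Prime 3) := ⟨Nat.prime_three⟩
  obtain ⟨u, hu⟩ := exists_prime_orderOf_dvd_card (G := (ZMod l)ˣ) 3 (by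
    rw [ZMod.card_units]; omega)
  have h1 : (u : ZMod l) ≠ 1 := fun h1 => by
    rw [Units.val_eq_one.1 h1, orderOf_one] at hu
    omega
  have h3 : (u : ZMod l) ^ 3 = 1 := by
    rw [← Units.val_pow_eq_pow_val, ← hu, pow_orderOf_eq_one, Units.val_one]
  refine ⟨u, (mul_eq_zero.1 (?_ : ((u : ZMod l) - 1) * _ = 0)).resolve_left (sub_ne_zero.2 h1)⟩
  linear_combination h3

end Prime

/-! ### Consequences of maximality and of transitivity. -/

section MatGroup

theorem act_ne_zero {d : ℕ} (G : GL2 d) {p : Index d} (hp : p ≠ 0) : act G p ≠ 0 := fun h => hp (by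
  rw [← act_one p, ← inv_mul_cancel G, act_mul, h]
  exact mulVec_zero _)

variable {d : ℕ} [NeZero d] {z : ZMod d → ℂ}

theorem symGroup_le_matGroup (z : ZMod d → ℂ) : symGroup z ≤ matGroup z :=
  fun _ hG => ⟨1, one_mem _, fun p => Subtype.ext (hG p).symm⟩

theorem MaximalAbelianConjecture.commute (hM : MaximalAbelianConjecture z) {G H : GL2 d}
    (hG : G ∈ matGroup z) (hH : H ∈ matGroup z) : G * H = H * G :=
  hM.2.prop.2 G hG H hH

/-- Adjoining `G` to `M` keeps it abelian, and `G` centralizes `S` because `S ≤ M`. -/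
theorem MaximalAbelianConjecture.mem_of_commute (hM : MaximalAbelianConjecture z) {G : GL2 d}
    (hG : ∀ H ∈ matGroup z, G * H = H * G) : G ∈ matGroup z := by
  set B := Subgroup.closure (insert G (matGroup z : Set (GL2 d))) with hB
  have hcomm : ∀ x ∈ insert G (matGroup z : Set (GL2 d)),
      ∀ y ∈ insert G (matGroup z : Set (GL2 d)), x * y = y * x := by
    rintro x (rfl | hx) y (rfl | hy)
    · rfl
    · exact hG y hy
    · exact (hG x hx).symm
    · exact hM.commute hx hy
  have hle : matGroup z ≤ B := fun x hx => Subgroup.subset_closure (Set.mem_insert_of_mem _ hx)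
  refine hM.2.le_of_ge ⟨?_, ?_⟩ hle (Subgroup.subset_closure (Set.mem_insert _ _))
  · refine (Subgroup.closure_le _).2 ?_
    rintro x (rfl | hx)
    · exact Subgroup.mem_centralizer_iff.2 fun S hS => (hG S (symGroup_le_matGroup z hS)).symm
    · exact hM.2.prop.1 hx
  · intro x hx y hy
    have := Subgroup.isMulCommutative_closure hcomm
    exact setLike_mul_comm hx hy

theorem MaximalAbelianConjecture.exists_mem (hM : MaximalAbelianConjecture z)
    (X : Matrix (Fin 2) (Fin 2) (ZMod (dbar d))) (hX : IsUnit X.det)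
    (hcomm : ∀ H ∈ matGroup z, X * (H : Matrix (Fin 2) (Fin 2) (ZMod (dbar d))) = H * X) :
    ∃ G ∈ matGroup z, (G : Matrix (Fin 2) (Fin 2) (ZMod (dbar d))) = X :=
  ⟨GeneralLinearGroup.mk'' X hX,
    hM.mem_of_commute fun H hH => Units.ext (hcomm H hH), rfl⟩

theorem MaximalAbelianConjecture.exists_mem_of_mem (hM : MaximalAbelianConjecture z)
    {G : GL2 d} (hG : G ∈ matGroup z) (a b : ZMod (dbar d))
    (hX : IsUnit (a • (1 : Matrix (Fin 2) (Fin 2) (ZMod (dbar d))) +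
      b • (G : Matrix (Fin 2) (Fin 2) (ZMod (dbar d)))).det) :
    ∃ H ∈ matGroup z, (H : Matrix (Fin 2) (Fin 2) (ZMod (dbar d))) =
      a • (1 : Matrix (Fin 2) (Fin 2) (ZMod (dbar d))) +
        b • (G : Matrix (Fin 2) (Fin 2) (ZMod (dbar d))) := by
  refine hM.exists_mem _ hX fun H hH => ?_
  have := congrArg Units.val (hM.commute hG hH)
  simp only [Units.val_mul] at this
  rw [add_mul, mul_add, smul_mul_assoc, smul_mul_assoc, mul_smul_comm, mul_smul_comm, this,
    one_mul, mul_one]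

theorem exists_act_overlap_eq (hM : MaximalAbelianConjecture z) (hC : AllPhasesConjugate z)
    {p q : Index d} (hp : IsPhaseIndex p) (hq : IsPhaseIndex q) :
    ∃ G ∈ matGroup z, overlap z (act G p) = overlap z q := by
  obtain ⟨g, hg, e⟩ := hC p q hp hq
  obtain ⟨G, hG⟩ := hM.1 g hg
  exact ⟨G, ⟨g, hg, hG⟩, congrArg Subtype.val ((hG p).symm.trans e)⟩

/-- The action on indices descends to overlap values, being induced by a field automorphism. -/
theorem overlap_act_congr {G : GL2 d} (hG : G ∈ matGroup z) {p q : Index d}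
    (h : overlap z p = overlap z q) : overlap z (act G p) = overlap z (act G q) := by
  obtain ⟨g, -, hg⟩ := hG
  have : overlapE1 z p = overlapE1 z q := Subtype.ext h
  exact congrArg Subtype.val ((hg p).symm.trans ((congrArg g this).trans (hg q)))

/-- A transitive abelian group acts freely: an element of `M` that fixes one overlap phase fixes
all of them. -/
theorem overlap_act_eq (hM : MaximalAbelianConjecture z) (hC : AllPhasesConjugate z)
    {G : GL2 d} (hG : G ∈ matGroup z) {p : Index d} (hp : IsPhaseIndex p)
    (h : overlap z (act G p) = overlap z p) {q : Index d} (hq : IsPhaseIndex q) :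
    overlap z (act G q) = overlap z q := by
  obtain ⟨H, hH, e⟩ := exists_act_overlap_eq hM hC hp hq
  rw [← overlap_act_congr hG e, ← act_mul, hM.commute hG hH, act_mul, overlap_act_congr hH h, e]

/-- The reduction of a matrix modulo a divisor `ℓ` of the modulus. -/
def red {n l : ℕ} (h : l ∣ n) :
    Matrix (Fin 2) (Fin 2) (ZMod n) →+* Matrix (Fin 2) (Fin 2) (ZMod l) :=
  (ZMod.castHom h (ZMod l)).mapMatrix

theorem trace_red {n l : ℕ} (h : l ∣ n) (A : Matrix (Fin 2) (Fin 2) (ZMod n)) :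
    (red h A).trace = ZMod.castHom h (ZMod l) A.trace := by
  rw [trace_fin_two, trace_fin_two, map_add]; rfl

theorem det_red {n l : ℕ} (h : l ∣ n) (A : Matrix (Fin 2) (Fin 2) (ZMod n)) :
    (red h A).det = ZMod.castHom h (ZMod l) A.det :=
  (RingHom.map_det _ _).symm

theorem red_smul {n l : ℕ} (h : l ∣ n) (c : ZMod n) (A : Matrix (Fin 2) (Fin 2) (ZMod n)) :
    red h (c • A) = ZMod.castHom h (ZMod l) c • red h A := by
  ext i j
  exact map_mul (ZMod.castHom h (ZMod l)) _ _

theorem red_mulVec {n l : ℕ} (h : l ∣ n) (A : Matrix (Fin 2) (Fin 2) (ZMod n))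
    (v : Fin 2 → ZMod n) :
    red h A *ᵥ (ZMod.castHom h (ZMod l) ∘ v) = ZMod.castHom h (ZMod l) ∘ (A *ᵥ v) := by
  ext i
  exact (RingHom.map_mulVec _ _ _ i).symm

theorem red_commute {n l : ℕ} (h : l ∣ n) {A B : Matrix (Fin 2) (Fin 2) (ZMod n)}
    (hAB : A * B = B * A) : red h A * red h B = red h B * red h A := by
  rw [← map_mul, hAB, map_mul]

theorem det_red_ne_zero {n l : ℕ} [Fact l.Prime] (h : l ∣ n) (G : GL (Fin 2) (ZMod n)) :
    (red h (G : Matrix (Fin 2) (Fin 2) (ZMod n))).det ≠ 0 := by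
  rw [det_red]
  exact (((Matrix.isUnit_iff_isUnit_det _).1 G.isUnit).map (ZMod.castHom h (ZMod l))).ne_zero

/-- Multiplication by `m` embeds `ℤ/l` in `ℤ/n`; this turns vectors modulo `l` into indices. -/
theorem mul_eq_zero_iff_castHom {n l m : ℕ} [NeZero n] (hn : n = l * m) (x : ZMod n) :
    (m : ZMod n) * x = 0 ↔ ZMod.castHom (Dvd.intro m hn.symm) (ZMod l) x = 0 := by
  have hm : 0 < m := Nat.pos_of_ne_zero fun h => NeZero.ne n (by rw [hn, h, mul_zero])
  have e : x = (x.val : ZMod n) := (ZMod.natCast_zmod_val x).symm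
  rw [e, map_natCast, ← Nat.cast_mul, ZMod.natCast_eq_zero_iff, ZMod.natCast_eq_zero_iff]
  generalize x.val = y
  rw [hn, mul_comm l, Nat.mul_dvd_mul_iff_left hm]

theorem isUnit_of_castHom_ne_zero {n l k : ℕ} [Fact l.Prime] (hn : n = l ^ k) (h : l ∣ n)
    {x : ZMod n} (hx : ZMod.castHom h (ZMod l) x ≠ 0) : IsUnit x := by
  have hl : l.Prime := Fact.out
  have : NeZero n := ⟨by rw [hn]; exact pow_ne_zero _ hl.ne_zero⟩
  have e : x = (x.val : ZMod n) := (ZMod.natCast_zmod_val x).symm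
  rw [e, map_natCast, Ne, ZMod.natCast_eq_zero_iff] at hx
  rw [e, ZMod.isUnit_iff_coprime]
  generalize x.val = y at hx
  rw [hn]
  exact (((Nat.Prime.coprime_iff_not_dvd hl).2 hx).pow_left k).symm

theorem isPhaseIndex_of_odd (h : Odd d) {p : Index d} : IsPhaseIndex p ↔ p ≠ 0 := by
  have hn : dbar d = d := if_pos h
  have key : ∀ i, d ∣ (p i).val ↔ p i = 0 := fun i => by
    have e := ZMod.natCast_eq_zero_iff (p i).val (dbar d)
    rw [ZMod.natCast_zmod_val] at e
    generalize (p i).val = y at e ⊢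
    rw [e, hn]
  simp only [IsPhaseIndex, key, ← not_forall, ne_eq, funext_iff, Pi.zero_apply]

/-- An element of `M` that fixes a non-zero vector modulo a prime `ℓ ∣ d` fixes all overlap
phases. -/
theorem overlap_act_eq_of_red (h : Odd d) (hM : MaximalAbelianConjecture z)
    (hC : AllPhasesConjugate z) {l m : ℕ} (hd : dbar d = l * m) {G : GL2 d}
    (hG : G ∈ matGroup z) {v : Fin 2 → ZMod l} (hv : v ≠ 0)
    (hGv : red (Dvd.intro m hd.symm) (G : Matrix (Fin 2) (Fin 2) (ZMod (dbar d))) *ᵥ v = v)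
    {q : Index d} (hq : q ≠ 0) : overlap z (act G q) = overlap z q := by
  set π := ZMod.castHom (Dvd.intro m hd.symm) (ZMod l) with hπ
  obtain ⟨w, rfl⟩ : ∃ w : Index d, v = π ∘ w := by
    choose f hf using ZMod.ringHom_surjective π
    exact ⟨f ∘ v, by ext i; simp [hf]⟩
  rw [red_mulVec] at hGv
  refine overlap_act_eq hM hC hG (p := (m : ZMod (dbar d)) • w) ?_ ?_
    ((isPhaseIndex_of_odd h).2 hq)
  · refine (isPhaseIndex_of_odd h).2 fun h0 => hv ?_
    ext i
    exact (mul_eq_zero_iff_castHom hd _).1 (congrFun h0 i)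
  · congr 1
    rw [act, mulVec_smul]
    ext i
    have := congrFun hGv i
    rw [← sub_eq_zero] at this ⊢
    simp only [Function.comp_apply] at this
    rw [← map_sub, ← mul_eq_zero_iff_castHom hd] at this
    simpa [mul_sub] using this

/-- In an odd dimension at least `7` some element of `M` changes the real part of some overlap
phase. -/
theorem not_forall_re_act_eq (h : Odd d) (hd : 7 ≤ d) (hz : IsFiducial z)
    (hM : MaximalAbelianConjecture z) (hC : AllPhasesConjugate z)
    (hS : ∀ G ∈ matGroup z, ∀ q : Index d, q ≠ 0 →
      (overlap z (act G q)).re = (overlap z q).re) : False := by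
  have hn : dbar d = d := if_pos h
  have key : ∀ a b : ZMod d, (a, b) ≠ 0 →
      ∃ p : Index d, p ≠ 0 ∧ overlap z p = oddOverlap z a b := fun a b hab => by
    refine ⟨![a.val, b.val], fun h0 => hab ?_, overlap_of_odd h z _ a b rfl rfl⟩
    have h0' := congrFun h0 0
    have h1' := congrFun h0 1
    simp only [cons_val_zero, cons_val_one, Pi.zero_apply, ZMod.natCast_eq_zero_iff] at h0' h1'
    rw [hn, ← ZMod.natCast_eq_zero_iff, ZMod.natCast_zmod_val] at h0' h1'
    rw [h0', h1']; rfl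
  have : Fact (1 < d) := ⟨by omega⟩
  refine hz.not_re_eq h hd (oddOverlap z 1 0).re fun a b hab => ?_
  obtain ⟨p, hp, ep⟩ := key a b hab
  obtain ⟨q, hq, eq⟩ := key 1 0 (by simp)
  obtain ⟨G, hG, e⟩ := exists_act_overlap_eq hM hC ((isPhaseIndex_of_odd h).2 hq)
    ((isPhaseIndex_of_odd h).2 hp)
  rw [← ep, ← eq, ← e, hS G hG q hq]

theorem overlap_neg_of_odd (h : Odd d) (z : ZMod d → ℂ) (p : Index d) :
    overlap z (-p) = star (overlap z p) := by
  have hn : dbar d = d := if_pos h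
  have key : ∀ x : ZMod (dbar d), (((x.val : ZMod d)).val : ZMod (dbar d)) = x ∧
      ((-(x.val : ZMod d)).val : ZMod (dbar d)) = -x := by
    rw [hn]
    intro x
    simp
  rw [overlap_of_odd h z p ((p 0).val : ZMod d) ((p 1).val : ZMod d) (key _).1.symm (key _).1.symm,
    overlap_of_odd h z (-p) (-((p 0).val : ZMod d)) (-((p 1).val : ZMod d)) (key _).2.symm
      (key _).2.symm, oddOverlap_neg_neg h]

end MatGroup

section Transitivity

variable {d : ℕ} [NeZero d] {z : ZMod d → ℂ}

/-- An invertible triangular matrix modulo 2 has both diagonal entries 1, hence trace 0 rather than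
1. -/
theorem odd_val_of_trace {n : ℕ} [NeZero n] (h2 : 2 ∣ n) (F : GL (Fin 2) (ZMod n))
    (htr : (F : Matrix (Fin 2) (Fin 2) (ZMod n)).trace = -1) :
    Odd ((F : Matrix (Fin 2) (Fin 2) (ZMod n)) 1 0).val := by
  set A : Matrix (Fin 2) (Fin 2) (ZMod n) := ↑F with hA
  have key : ∀ a b c e : ZMod 2, a + e = -1 → a * e - b * c ≠ 0 → c ≠ 0 := by decide
  have : Fact (Nat.Prime 2) := ⟨Nat.prime_two⟩
  have hdet := det_red_ne_zero h2 F
  have ht := trace_red h2 A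
  rw [htr, map_neg, map_one, trace_fin_two] at ht
  rw [← hA, det_fin_two] at hdet
  have hc := key _ _ _ _ ht hdet
  have e : red h2 A 1 0 = ((A 1 0).val : ZMod 2) := by
    rw [← map_natCast (ZMod.castHom h2 (ZMod 2)), ZMod.natCast_zmod_val]; rfl
  rw [e, Ne, ZMod.natCast_eq_zero_iff_even] at hc
  exact Nat.not_even_iff_odd.1 hc

theorem not_allPhasesConjugate_of_even (hd : 3 < d) (h : Even d) (hz : IsFiducial z)
    {F : GL2 d} (hF : F ∈ symGroup z)
    (htr : (F : Matrix (Fin 2) (Fin 2) (ZMod (dbar d))).trace = -1)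
    (hM : MaximalAbelianConjecture z) : ¬ AllPhasesConjugate z := by
  intro hC
  have hn : dbar d = 2 * d := if_neg (Nat.not_odd_iff_even.2 h)
  set A : Matrix (Fin 2) (Fin 2) (ZMod (dbar d)) := ↑F with hA
  have h2d : (2 : ZMod (dbar d)) * d = 0 := by
    rw [← Nat.cast_ofNat, ← Nat.cast_mul, ← hn, ZMod.natCast_self]
  have hdd : (d : ZMod (dbar d)) * d = 0 := by
    obtain ⟨k, hk⟩ := h
    have : (d : ZMod (dbar d)) = 2 * k := by rw [hk]; push_cast; ring
    nth_rw 1 [this]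
    linear_combination (k : ZMod (dbar d)) * h2d
  -- Since `d² = 0` modulo `2d`, the inverse of `1 + dF` is `1 - dF`.
  have hunit : IsUnit ((1 : ZMod (dbar d)) • (1 : Matrix (Fin 2) (Fin 2) (ZMod (dbar d))) +
      (d : ZMod (dbar d)) • A).det := by
    refine isUnit_det_of_right_inverse (B := 1 - (d : ZMod (dbar d)) • A) ?_
    rw [one_smul, add_mul, mul_sub, mul_sub, smul_mul_smul_comm, hdd, zero_smul]
    simp
  obtain ⟨H, hH, eH⟩ := hM.exists_mem_of_mem (symGroup_le_matGroup z hF) _ _ hunit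
  have hact : ∀ p : Index d, act H p = p + (d : ZMod (dbar d)) • (A *ᵥ p) := fun p => by
    rw [act, eH, one_smul, add_mulVec, one_mulVec, smul_mulVec]
  have h2 : IsPhaseIndex (![2, 0] : Index d) := ⟨0, fun hdvd => by
    have e : (2 : ZMod (dbar d)).val = 2 := by
      have := ZMod.val_natCast_of_lt (show 2 < dbar d by omega)
      simpa using this
    rw [cons_val_zero, e] at hdvd
    have := Nat.le_of_dvd two_pos hdvd
    omega⟩
  have h1 : IsPhaseIndex (![1, 0] : Index d) := ⟨0, fun hdvd => by
    have e : (1 : ZMod (dbar d)).val = 1 := by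
      have := ZMod.val_natCast_of_lt (show 1 < dbar d by omega)
      simpa using this
    rw [cons_val_zero, e] at hdvd
    have := Nat.le_of_dvd one_pos hdvd
    omega⟩
  have hfix : act H ![2, 0] = ![2, 0] := by
    rw [hact, mulVec_fin_two]
    ext i
    fin_cases i
    · simp
      linear_combination A 0 0 * h2d
    · simp
      linear_combination A 1 0 * h2d
  have e := overlap_act_eq hM hC hH h2 (congrArg _ hfix) h1
  have hodd := odd_val_of_trace (by rw [hn]; exact dvd_mul_right 2 d) F htr
  have e' := overlap_translate_of_even h z ![1, 0] (act H ![1, 0]) (A 0 0).val (A 1 0).val hodd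
    rfl rfl (by rw [hact, mulVec_fin_two]; simp) (by rw [hact, mulVec_fin_two]; simp)
  rw [e, self_eq_neg] at e'
  have hnorm := hz.norm_sq_overlap _ h1
  rw [e', norm_zero] at hnorm
  have : (0 : ℝ) < 1 / (d + 1) := by positivity
  norm_num at hnorm
  have hd0 : (0 : ℝ) ≤ d := Nat.cast_nonneg d
  linarith

/-- In an odd dimension with two coprime factors every element of `M` fixes all phases. -/
theorem overlap_act_eq_of_coprime (h : Odd d) (hM : MaximalAbelianConjecture z)
    (hC : AllPhasesConjugate z) {a b : ℕ} (hab : a.Coprime b) (ha : 1 < a) (hb : 1 < b)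
    (hd : d = a * b) {G : GL2 d} (hG : G ∈ matGroup z) {q : Index d} (hq : q ≠ 0) :
    overlap z (act G q) = overlap z q := by
  have hn : dbar d = a * b := (if_pos h).trans hd
  set A : Matrix (Fin 2) (Fin 2) (ZMod (dbar d)) := ↑G with hA
  set B : Matrix (Fin 2) (Fin 2) (ZMod (dbar d)) := ↑(G⁻¹ : GL2 d) with hB
  have hAB : A * B = 1 := by rw [hA, hB, ← Units.val_mul, mul_inv_cancel, Units.val_one]
  -- Bézout gives the idempotent that is 1 modulo `a` and 0 modulo `b`. Then `(1 - e) + eG` and `e +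
  -- (1 - e)G` each act as `G` on one factor and trivially on the other, and their product is `G`.
  obtain ⟨e, he0, he1⟩ : ∃ e : ZMod (dbar d), e * a = 0 ∧ (1 - e) * b = 0 := by
    refine ⟨(b * Nat.gcdB a b : ℤ), ?_, ?_⟩
    · have : ((a * b : ℕ) : ZMod (dbar d)) = 0 := by rw [← hn, ZMod.natCast_self]
      push_cast at this ⊢
      linear_combination (Nat.gcdB a b : ZMod (dbar d)) * this
    · have := congrArg (Int.cast : ℤ → ZMod (dbar d)) (Nat.gcd_eq_gcd_ab a b)
      have hab0 : ((a * b : ℕ) : ZMod (dbar d)) = 0 := by rw [← hn, ZMod.natCast_self]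
      rw [hab.gcd_eq_one] at this
      push_cast at this hab0 ⊢
      linear_combination (b : ZMod (dbar d)) * this + (Nat.gcdA a b : ZMod (dbar d)) * hab0
  have hee : e * (1 - e) = 0 := by
    have hone : (Nat.gcdA a b : ZMod (dbar d)) * a + (Nat.gcdB a b : ZMod (dbar d)) * b = 1 := by
      have := congrArg (Int.cast : ℤ → ZMod (dbar d)) (Nat.gcd_eq_gcd_ab a b)
      rw [hab.gcd_eq_one] at this
      push_cast at this
      linear_combination -this
    linear_combination -(e * (1 - e)) * hone + (1 - e) * (Nat.gcdA a b : ZMod (dbar d)) * he0 +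
      e * (Nat.gcdB a b : ZMod (dbar d)) * he1
  have hunit : ∀ f : ZMod (dbar d), f * (1 - f) = 0 →
      IsUnit ((1 - f) • (1 : Matrix (Fin 2) (Fin 2) (ZMod (dbar d))) + f • A).det := fun f hf => by
    refine isUnit_det_of_right_inverse (B := (1 - f) • 1 + f • B) ?_
    rw [add_mul, mul_add, mul_add, smul_mul_smul_comm, smul_mul_smul_comm, smul_mul_smul_comm,
      smul_mul_smul_comm, hAB, mul_comm (1 - f) f, hf, zero_smul, zero_smul, add_zero, zero_add,
      one_mul, ← add_smul]
    rw [show (1 - f) * (1 - f) + f * f = 1 by linear_combination -2 * hf, one_smul]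
  have hfix : ∀ (f : ZMod (dbar d)) (c : ℕ), f * (1 - f) = 0 → f * c = 0 → ¬ d ∣ c →
      ∃ H ∈ matGroup z, (H : Matrix (Fin 2) (Fin 2) (ZMod (dbar d))) = (1 - f) • 1 + f • A ∧
        ∀ q : Index d, q ≠ 0 → overlap z (act H q) = overlap z q := fun f c hf hfc hdc => by
    obtain ⟨H, hH, eH⟩ := hM.exists_mem_of_mem hG _ _ (hunit f hf)
    refine ⟨H, hH, eH, fun q hq => ?_⟩
    refine overlap_act_eq hM hC hH (p := (c : ZMod (dbar d)) • ![1, 0]) ?_ (congrArg _ ?_)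
      ((isPhaseIndex_of_odd h).2 hq)
    · refine (isPhaseIndex_of_odd h).2 fun h0 => hdc ?_
      have := congrFun h0 0
      simp only [Pi.smul_apply, cons_val_zero, smul_eq_mul, mul_one, Pi.zero_apply] at this
      rwa [ZMod.natCast_eq_zero_iff, hn, ← hd] at this
    · rw [act, eH, add_mulVec, smul_mulVec, smul_mulVec, one_mulVec, mulVec_smul, smul_smul,
        smul_smul, hfc, zero_smul, add_zero, sub_mul, hfc, one_mul, sub_zero]
  have hdvd : ∀ c, 1 ≤ c → c < d → ¬ d ∣ c := fun c h1 h2 h3 => by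
    have := Nat.le_of_dvd h1 h3
    omega
  obtain ⟨H, hH, eH, fH⟩ := hfix e a hee he0 (hdvd a (by omega) (by rw [hd]; nlinarith))
  obtain ⟨H', hH', eH', fH'⟩ := hfix (1 - e) b (by linear_combination hee) he1
    (hdvd b (by omega) (by rw [hd]; nlinarith))
  have : G = H * H' := by
    ext1
    rw [Units.val_mul, eH, eH', ← hA, sub_sub_cancel, add_mul, mul_add, mul_add,
      smul_mul_smul_comm, smul_mul_smul_comm, smul_mul_smul_comm, smul_mul_smul_comm,
      mul_comm (1 - e) e, hee, mul_comm (1 - e) (1 - e)]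
    have e1 : (1 - e) * (1 - e) = 1 - e := by linear_combination -hee
    have e2 : e * e = e := by linear_combination -hee
    rw [e1, e2, zero_smul, zero_add, zero_smul, add_zero, one_mul, mul_one, ← add_smul,
      sub_add_cancel, one_smul]
  rw [this, act_mul, fH _ (act_ne_zero H' hq), fH' q hq]

/-- In a power of a prime `ℓ ≡ 1` modulo `3` every element of `M` fixes all phases. -/
theorem overlap_act_eq_of_mod_three_eq_one (h : Odd d) (hM : MaximalAbelianConjecture z)
    (hC : AllPhasesConjugate z) {F : GL2 d} (hF : F ∈ symGroup z) (hF3 : F ^ 3 = 1)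
    (htr : (F : Matrix (Fin 2) (Fin 2) (ZMod (dbar d))).trace = -1)
    {l k : ℕ} [Fact l.Prime] (hl : l % 3 = 1) (hd : d = l ^ (k + 1))
    {G : GL2 d} (hG : G ∈ matGroup z) {q : Index d} (hq : q ≠ 0) :
    overlap z (act G q) = overlap z q := by
  have hn : dbar d = l ^ (k + 1) := (if_pos h).trans hd
  have hn' : dbar d = l * l ^ k := by rw [hn, pow_succ']
  have hdvd : l ∣ dbar d := Dvd.intro _ hn'.symm
  set A := red hdvd (F : Matrix (Fin 2) (Fin 2) (ZMod (dbar d))) with hA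
  set B := red hdvd (G : Matrix (Fin 2) (Fin 2) (ZMod (dbar d))) with hB
  have hAB : A * B = B * A := red_commute hdvd
    (congrArg Units.val (hM.commute (symGroup_le_matGroup z hF) hG))
  have h3 : (3 : ZMod l) ≠ 0 := three_ne_zero_of_prime (by omega)
  have hA3 : A ^ 3 = 1 := by rw [hA, ← map_pow, ← Units.val_pow_eq_pow_val, hF3]; simp
  have hAtr : A.trace = -1 := by rw [hA, trace_red, htr, map_neg, map_one]
  have hAdet := det_eq_one_of_cube h3 hA3 hAtr
  obtain ⟨c, hc⟩ := exists_primitive_cube_root hl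
  have hc' : (-1 - c) ^ 2 + (-1 - c) + 1 = 0 := by linear_combination hc
  have hne : c - (-1 - c) ≠ 0 := fun h0 => h3 (by linear_combination 4 * hc - (2 * c + 1) * h0)
  obtain ⟨v, hv, hAv⟩ := exists_eigenvector (A := A) (c := c)
    (by rw [hAtr, hAdet]; linear_combination hc)
  obtain ⟨w, hw, hAw⟩ := exists_eigenvector (A := A) (c := -1 - c)
    (by rw [hAtr, hAdet]; linear_combination hc')
  obtain ⟨g, hg⟩ := exists_smul_of_eigenvector h3 hAtr hc hv hAv (w := B *ᵥ v) (by
    rw [mulVec_mulVec, hAB, ← mulVec_mulVec, hAv, mulVec_smul])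
  have hg0 : g ≠ 0 := by
    rintro rfl
    rw [zero_smul] at hg
    exact det_red_ne_zero hdvd G (exists_mulVec_eq_zero_iff.1 ⟨v, hv, hg⟩)
  -- Interpolation: `a + bF` shall have eigenvalue `g` on `v`, like `G`, and 1 on `w`. The resulting
  -- `H` fixes `w`, and `H⁻¹G` fixes `v`.
  obtain ⟨a, b, hab1, hab2⟩ : ∃ a b : ZMod l, a + b * c = g ∧ a + b * (-1 - c) = 1 := by
    refine ⟨g - (g - 1) / (c - (-1 - c)) * c, (g - 1) / (c - (-1 - c)), by ring, ?_⟩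
    have := div_mul_cancel₀ (g - 1) hne
    linear_combination -this
  have hsurj := ZMod.ringHom_surjective (ZMod.castHom hdvd (ZMod l))
  obtain ⟨a', rfl⟩ := hsurj a
  obtain ⟨b', rfl⟩ := hsurj b
  have hredX : red hdvd (a' • (1 : Matrix (Fin 2) (Fin 2) (ZMod (dbar d))) +
      b' • (F : Matrix (Fin 2) (Fin 2) (ZMod (dbar d)))) =
      ZMod.castHom hdvd (ZMod l) a' • 1 + ZMod.castHom hdvd (ZMod l) b' • A := by
    rw [map_add, red_smul, red_smul, map_one]
  generalize ha : ZMod.castHom hdvd (ZMod l) a' = a at hab1 hab2 hredX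
  generalize hb : ZMod.castHom hdvd (ZMod l) b' = b at hab1 hab2 hredX
  obtain ⟨H, hH, eH⟩ := hM.exists_mem_of_mem (symGroup_le_matGroup z hF) a' b' (by
    refine isUnit_of_castHom_ne_zero hn hdvd ?_
    rw [← det_red, hredX]
    have : (a • (1 : Matrix (Fin 2) (Fin 2) (ZMod l)) + b • A).det =
        (a + b * c) * (a + b * (-1 - c)) := by
      rw [trace_fin_two] at hAtr
      rw [det_fin_two] at hAdet ⊢
      simp
      linear_combination a * b * hAtr + b ^ 2 * hAdet + b ^ 2 * hc
    rw [this, hab1, hab2, mul_one]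
    exact hg0)
  have hHu : ∀ (u : Fin 2 → ZMod l) (t : ZMod l), A *ᵥ u = t • u →
      red hdvd (H : Matrix (Fin 2) (Fin 2) (ZMod (dbar d))) *ᵥ u = (a + b * t) • u :=
    fun u t hu => by
      rw [eH, hredX, add_mulVec, smul_mulVec, smul_mulVec, one_mulVec, hu, smul_smul, add_smul]
  have fH := fun {q} (hq : q ≠ 0) => overlap_act_eq_of_red h hM hC hn' hH hw
    (by rw [hHu w _ hAw, hab2, one_smul]) (q := q) hq
  have hHG : H⁻¹ * G ∈ matGroup z := mul_mem (inv_mem hH) hG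
  have fHG := overlap_act_eq_of_red h hM hC hn' hHG hv (by
    have e1 : red hdvd ((H⁻¹ : GL2 d) : Matrix (Fin 2) (Fin 2) (ZMod (dbar d))) *ᵥ
        (red hdvd (H : Matrix (Fin 2) (Fin 2) (ZMod (dbar d))) *ᵥ v) = v := by
      rw [mulVec_mulVec, ← map_mul, ← Units.val_mul, inv_mul_cancel]
      simp
    rw [Units.val_mul, map_mul, ← mulVec_mulVec, ← hB, hg, ← hab1, ← hHu v c hAv, e1]) hq
  rw [← fHG, ← fH (act_ne_zero (H⁻¹ * G) hq), ← act_mul, mul_inv_cancel_left]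

/-- In a higher power of an odd prime each element of `M` has an eigenvector modulo the prime. -/
theorem not_noEigenvector (h : Odd d) (hz : IsFiducial z) (hM : MaximalAbelianConjecture z)
    (hC : AllPhasesConjugate z) {l k : ℕ} [Fact l.Prime] (hd : d = l ^ (k + 2))
    (hdvd : l ∣ dbar d) {G : GL2 d} (hG : G ∈ matGroup z) :
    ¬ NoEigenvector (red hdvd (G : Matrix (Fin 2) (Fin 2) (ZMod (dbar d)))) := by
  intro hno
  have hl : l.Prime := Fact.out
  set m := l ^ (k + 1) with hm
  have hn0 : dbar d = d := if_pos h
  have hn : dbar d = l ^ (k + 2) := hn0.trans hd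
  have hdm : d = l * m := by rw [hd, hm, pow_succ' l (k + 1)]
  have hn' : dbar d = l * m := hn0.trans hdm
  have hlm : l ≤ m := Nat.le_self_pow (by omega) l
  have hm0 : (m : ZMod l) = 0 := by rw [hm]; simp
  have hcast : ∀ b : ZMod d, ((b + m).val : ZMod (dbar d)) = b.val + m := fun b => by
    rw [← Nat.cast_add, ZMod.natCast_eq_natCast_iff, hn0, ← ZMod.natCast_eq_natCast_iff]
    simp
  refine hz.not_periodic h hl.two_le hlm hdm fun a b ha => ?_
  set v : Index d := ![a.val, b.val] with hv
  have hv0 : ZMod.castHom hdvd (ZMod l) ∘ v ≠ 0 := fun h0 => by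
    rw [mul_comm, mul_eq_zero_iff_castHom hdm, map_sub, map_one, sub_eq_zero] at ha
    have := congrFun h0 0
    simp only [hv, Function.comp_apply, cons_val_zero, map_natCast, Pi.zero_apply] at this
    rw [ZMod.castHom_apply, ← ZMod.natCast_val, this] at ha
    exact zero_ne_one ha
  -- With `X = s + tG` sending `v` to `(0, 1)` modulo `l`, the matrix `1 + mX` translates `v` by
  -- exactly `(0, m)`. It is the identity modulo `l`, because `l` divides `m`, so it fixes every
  -- phase.
  obtain ⟨s, t, hst⟩ := hno.exists_smul_add hv0 ![0, 1]
  have hsurj := ZMod.ringHom_surjective (ZMod.castHom hdvd (ZMod l))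
  obtain ⟨s, rfl⟩ := hsurj s
  obtain ⟨t, rfl⟩ := hsurj t
  rw [← red_smul, ← map_one (red hdvd), ← red_smul, ← map_add, red_mulVec] at hst
  set X : Matrix (Fin 2) (Fin 2) (ZMod (dbar d)) := s • 1 + t • (G : Matrix _ _ _) with hX
  have hY : (1 + m * s) • (1 : Matrix (Fin 2) (Fin 2) (ZMod (dbar d))) +
      (m * t) • (G : Matrix (Fin 2) (Fin 2) (ZMod (dbar d))) = 1 + (m : ZMod (dbar d)) • X := by
    rw [hX, smul_add, smul_smul, smul_smul, add_smul, one_smul, add_assoc]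
  have hred : red hdvd (1 + (m : ZMod (dbar d)) • X) = 1 := by
    rw [map_add, map_one, red_smul, map_natCast, hm0, zero_smul, add_zero]
  obtain ⟨H, hH, eH⟩ := hM.exists_mem_of_mem hG (1 + m * s) (m * t) (by
    refine isUnit_of_castHom_ne_zero hn hdvd ?_
    rw [← det_red, hY, hred, det_one]
    exact one_ne_zero)
  rw [hY] at eH
  have hvne : v ≠ 0 := fun h0 => hv0 (by rw [h0]; ext i; simp)
  have e := overlap_act_eq_of_red h hM hC hn' hH (v := ![0, 1]) (fun h0 => by
    simpa using congrFun h0 1) (by rw [eH, hred, one_mulVec]) hvne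
  have hact : act H v = v + (m : ZMod (dbar d)) • (X *ᵥ v) := by
    rw [act, eH, add_mulVec, one_mulVec, smul_mulVec]
  have h0 : (m : ZMod (dbar d)) * (X *ᵥ v) 0 = 0 :=
    (mul_eq_zero_iff_castHom hn' _).2 (congrFun hst 0)
  have h1 : (m : ZMod (dbar d)) * ((X *ᵥ v) 1 - 1) = 0 :=
    (mul_eq_zero_iff_castHom hn' _).2 (by
      rw [map_sub, map_one, sub_eq_zero]; exact congrFun hst 1)
  rw [overlap_of_odd h z v a b rfl rfl, overlap_of_odd h z (act H v) a (b + m)] at e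
  · exact e
  · rw [hact, Pi.add_apply, Pi.smul_apply, smul_eq_mul, h0, add_zero]; rfl
  · rw [hact, Pi.add_apply, Pi.smul_apply, smul_eq_mul, hcast]
    change (b.val : ZMod (dbar d)) + _ = _
    linear_combination h1

/-- Modulo 3 an eigenvalue of `G` is 1 or -1, so `G` or `-G` fixes all phases; negating the index
conjugates the overlap. -/
theorem re_overlap_act_eq_of_three (h : Odd d) (hz : IsFiducial z)
    (hM : MaximalAbelianConjecture z) (hC : AllPhasesConjugate z) {k : ℕ} (hd : d = 3 ^ (k + 2))
    {G : GL2 d} (hG : G ∈ matGroup z) {q : Index d} (hq : q ≠ 0) :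
    (overlap z (act G q)).re = (overlap z q).re := by
  have hcases : ∀ c : ZMod 3, c = 0 ∨ c = 1 ∨ c = -1 := by decide
  have : Fact (Nat.Prime 3) := ⟨Nat.prime_three⟩
  have hn : dbar d = 3 * 3 ^ (k + 1) := by
    rw [show dbar d = d from if_pos h, hd, pow_succ' 3 (k + 1)]
  have hdvd : 3 ∣ dbar d := Dvd.intro _ hn.symm
  have hno := not_noEigenvector h hz hM hC hd hdvd hG
  simp only [NoEigenvector, not_forall, not_not] at hno
  obtain ⟨v, hv, c, hc⟩ := hno
  rcases hcases c with rfl | rfl | rfl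
  · rw [zero_smul] at hc
    exact absurd (exists_mulVec_eq_zero_iff.1 ⟨v, hv, hc⟩) (det_red_ne_zero hdvd G)
  · rw [one_smul] at hc
    rw [overlap_act_eq_of_red h hM hC hn hG hv hc hq]
  · have hG' : -G ∈ matGroup z := hM.mem_of_commute fun H hH => by
      rw [neg_mul, mul_neg, hM.commute hG hH]
    have e := overlap_act_eq_of_red h hM hC hn hG' hv (by
      rw [Units.val_neg, map_neg, neg_mulVec, hc, neg_smul, one_smul, neg_neg]) hq
    rw [← e, show act (-G) q = -act G q by rw [act, Units.val_neg, neg_mulVec]; rfl,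
      overlap_neg_of_odd h]
    simp

theorem prime_of_allPhasesConjugate (hd : 3 < d) (hz : IsFiducial z) {F : GL2 d}
    (hF : F ∈ symGroup z) (hF3 : F ^ 3 = 1)
    (htr : (F : Matrix (Fin 2) (Fin 2) (ZMod (dbar d))).trace = -1)
    (hM : MaximalAbelianConjecture z) (hC : AllPhasesConjugate z) :
    Odd d ∧ d.Prime ∧ d % 3 = 2 := by
  rcases Nat.even_or_odd d with h | h
  · exact absurd hC (not_allPhasesConjugate_of_even hd h hz hF htr hM)
  refine ⟨h, ?_⟩
  have hn0 : dbar d = d := if_pos h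
  set l := d.minFac with hl
  have hlp : l.Prime := Nat.minFac_prime (by omega)
  have : Fact l.Prime := ⟨hlp⟩
  obtain ⟨k, m, hlm, hdm⟩ := Nat.exists_eq_pow_mul_and_not_dvd (NeZero.ne d) l hlp.ne_one
  have hk : k ≠ 0 := by
    rintro rfl
    rw [pow_zero, one_mul] at hdm
    exact hlm (hdm ▸ Nat.minFac_dvd d)
  have hm0 : m ≠ 0 := by rintro rfl; exact hlm (dvd_zero l)
  obtain ⟨k, rfl⟩ : ∃ j, k = j + 1 := ⟨k - 1, by omega⟩
  by_cases hm : m = 1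
  · rw [hm, mul_one] at hdm
    have hdvd : l ∣ dbar d := by rw [hn0]; exact Nat.minFac_dvd d
    have hl3 : l % 3 = 1 ∨ l % 3 = 2 ∨ l = 3 := by
      rcases (show l % 3 = 1 ∨ l % 3 = 2 ∨ l % 3 = 0 by omega) with h1 | h1 | h1
      · exact Or.inl h1
      · exact Or.inr (Or.inl h1)
      · exact Or.inr (Or.inr ((Nat.prime_dvd_prime_iff_eq Nat.prime_three hlp).1
          (Nat.dvd_of_mod_eq_zero h1)).symm)
    rcases hl3 with h1 | h1 | h1
    · exfalso
      have hd7 : 7 ≤ d := by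
        have : l ≤ d := Nat.minFac_le (by omega)
        have h2 := hlp.two_le
        by_contra hlt
        -- The only residue 1 modulo 3 between 2 and 6.
        have : l = 4 := by omega
        rw [this] at hlp
        exact absurd hlp (by norm_num)
      exact not_forall_re_act_eq h hd7 hz hM hC fun G hG q hq => by
        rw [overlap_act_eq_of_mod_three_eq_one h hM hC hF hF3 htr h1 hdm hG hq]
    · rcases k with _ | k
      · rw [zero_add, pow_one] at hdm
        rw [← hdm] at hlp h1
        exact ⟨hlp, h1⟩
      · refine absurd ?_ (not_noEigenvector h hz hM hC hdm hdvd (symGroup_le_matGroup z hF))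
        refine noEigenvector_of_mod_three h1 ?_ ?_
        · rw [← map_pow, ← Units.val_pow_eq_pow_val, hF3]; simp
        · rw [trace_red, htr, map_neg, map_one]
    · exfalso
      rw [h1] at hdm
      rcases k with _ | k
      · omega
      · have hd7 : 7 ≤ d := by
          rw [hdm, pow_succ, pow_succ]
          have := Nat.one_le_pow k 3 (by norm_num)
          omega
        exact not_forall_re_act_eq h hd7 hz hM hC fun G hG q hq =>
          re_overlap_act_eq_of_three h hz hM hC hdm hG hq
  · exfalso
    have hl2 := hlp.two_le
    have hodd := h
    rw [hdm, Nat.odd_mul] at hodd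
    have hlo : Odd l := (Nat.odd_pow_iff (by omega)).1 hodd.1
    have hl3 : 3 ≤ l := by
      obtain ⟨r, hr⟩ := hlo
      omega
    have hm3 : 3 ≤ m := by
      obtain ⟨r, hr⟩ := hodd.2
      omega
    have hle : l ≤ l ^ (k + 1) := Nat.le_self_pow (by omega) l
    have hcop : (l ^ (k + 1)).Coprime m := ((Nat.Prime.coprime_iff_not_dvd hlp).2 hlm).pow_left _
    have hd7 : 7 ≤ d := by rw [hdm]; nlinarith
    exact not_forall_re_act_eq h hd7 hz hM hC fun G hG q hq => by
      rw [overlap_act_eq_of_coprime h hM hC hcop (by omega) (by omega) hdm hG hq]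

/-- Some `s + tF` carries `p` to `q`; it is invertible as a nonzero element of the field generated
by `F`, hence lies in `M`. -/
theorem allPhasesConjugate_of_prime (h : Odd d) (hp : d.Prime) (hd3 : d % 3 = 2) {F : GL2 d}
    (hF : F ∈ symGroup z) (hF3 : F ^ 3 = 1)
    (htr : (F : Matrix (Fin 2) (Fin 2) (ZMod (dbar d))).trace = -1)
    (hM : MaximalAbelianConjecture z) : AllPhasesConjugate z := by
  intro p q hp0 hq0
  rw [isPhaseIndex_of_odd h] at hp0 hq0
  have : Fact d.Prime := ⟨hp⟩
  have hn : dbar d = d := if_pos h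
  have hdvd : d ∣ dbar d := dvd_dbar d
  have hinj : Function.Injective (ZMod.castHom hdvd (ZMod d)) := by
    rw [injective_iff_map_eq_zero]
    intro x hx
    have := (mul_eq_zero_iff_castHom (l := d) (m := 1) (by rw [hn, mul_one]) x).2 hx
    simpa using this
  have hcomp : ∀ u v : Index d, ZMod.castHom hdvd (ZMod d) ∘ u = ZMod.castHom hdvd (ZMod d) ∘ v →
      u = v := fun u v huv => funext fun i => hinj (congrFun huv i)
  have hne : ∀ u : Index d, u ≠ 0 → ZMod.castHom hdvd (ZMod d) ∘ u ≠ 0 := fun u hu h0 =>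
    hu (hcomp u 0 (by rw [h0]; ext i; simp))
  have hno : NoEigenvector (red hdvd (F : Matrix (Fin 2) (Fin 2) (ZMod (dbar d)))) := by
    refine noEigenvector_of_mod_three hd3 ?_ ?_
    · rw [← map_pow, ← Units.val_pow_eq_pow_val, hF3]; simp
    · rw [trace_red, htr, map_neg, map_one]
  obtain ⟨s, t, hst⟩ := hno.exists_smul_add (hne p hp0) (ZMod.castHom hdvd (ZMod d) ∘ q)
  have hdet := hno.det_ne_zero (hst.trans_ne (hne q hq0))
  have hsurj := ZMod.ringHom_surjective (ZMod.castHom hdvd (ZMod d))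
  obtain ⟨s, rfl⟩ := hsurj s
  obtain ⟨t, rfl⟩ := hsurj t
  rw [← red_smul, ← map_one (red hdvd), ← red_smul, ← map_add] at hst hdet
  obtain ⟨G, ⟨g, hg, hGg⟩, eG⟩ := hM.exists_mem_of_mem (symGroup_le_matGroup z hF) s t
    (isUnit_of_castHom_ne_zero (k := 1) (by rw [hn, pow_one]) hdvd (by rwa [← det_red]))
  refine ⟨g, hg, (hGg p).trans (congrArg _ (hcomp _ _ ?_))⟩
  rw [← hst, red_mulVec, act, eG]

end Transitivity

end SIC

end

theorem mainTheorem7 (d : ℕ) [NeZero d] (hd : 3 < d) (z : ZMod d → ℂ)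
    (hz : SIC.IsStronglyCentred z) (hM : SIC.MaximalAbelianConjecture z) :
    SIC.AllPhasesConjugate z ↔ (3 < d ∧ Odd d ∧ d.Prime ∧ d ≡ 2 [MOD 3]) := by
  obtain ⟨⟨hfid, ⟨F, hF, hF3, htr⟩, -⟩, -⟩ := hz
  have hF3' : F ^ 3 = 1 := by rw [← hF3, pow_orderOf_eq_one]
  constructor
  · exact fun hC => ⟨hd, SIC.prime_of_allPhasesConjugate hd hfid hF hF3' htr hM hC⟩
  · rintro ⟨-, hodd, hp, hmod⟩
    exact SIC.allPhasesConjugate_of_prime hodd hp hmod hF hF3' htr hM
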